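/- **Lemma (ball inflation).** *Notation.* Let $\Gamma=\{\xi\in\mathbb R^3:\xi_1^2+\xi_2^2=\xi_3^2,\ \tfrac12\le|\xi_3|\le1\}$ and let $N_\delta(\Gamma)$ be its closed $\delta$-neighbourhood. For $\xi=(\cos\varphi,\sin\varphi,1)$ put $\mathbf c=(\cos\varphi,\sin\varphi,1)$, $\mathbf n=(\cos\varphi,\sin\varphi,-1)$, $\mathbf t=(-\sin\varphi,\cos\varphi,0)$. For $0<s<1$ the sector of aperture $s$ and direction $\xi$ is $$\tau(s,\xi)=\{\omega: 1\le\mathbf c\cdot\omega\le2,\ |\mathbf n\cdot\omega|\le s^2,\ |\mathbf t\cdot\omega|\le s\},$$ and $\mathbf S_s$ is the set of the sectors $\tau(s,\xi)$ for the $\lceil 10/s\rceil$ evenly spaced angles $\varphi=2\pi j/\lceil10/s\rceil$, $0\le j<\lceil 10/s\rceil$; for $s=1$, $\mathbf S_1$ consists of one sector, with $\varphi=0$, which stands for the whole cone. Write $\theta^\sharp=\{\omega:\tfrac12\le|\mathbf c\cdot\omega|\le\tfrac52,\ |\mathbf n\cdot\omega|\le2s^2,\ |\mathbf t\cdot\omega|\le2s\}$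 for the dilate of $\theta=\tau(s,\xi)$ by the factor $2$ about its centroid, together with its reflection in the origin. For $\tau$ of aperture $s$ and direction $\xi$, and $\rho\ge s^{-2}$, let $$U_{\tau,\rho}=\{x:|\mathbf c\cdot x|\le\rho s^2,\ |\mathbf n\cdot x|\le\rho,\ |\mathbf t\cdot x|\le\rho s\}.$$ Let $R>1$ and let $f$ be a function on $\mathbb R^3$ (a tempered distribution which is then automatically a smooth function) with $\operatorname{supp}\hat f\subset N_{R^{-1}}(\Gamma)$. Choose functions $f_\theta$, $\theta\in\mathbf S_{R^{-1/2}}$, with $f=\sum_\theta f_\theta$ and $\operatorname{supp}\hat f_\theta\subset\theta^\sharp$. For every $s\in[R^{-1/2},1]$ choose a partition $\mathbf S_{R^{-1/2}}=\bigsqcup_{\tau\in\mathbf S_s}A(\tau)$ such that, if $s<1$, every $\theta\in A(\tau)$ intersects $\tau$; "$\theta\subset\tau$" means $\theta\in A(\tau)$. Put $f_\tau=\sum_{\theta\subset\tau}f_\theta$. For a translate $U$ of $U_{\tau,R}$ put $S_Uf=\big(\sum_{\theta\subset\tau}|f_\theta|^2\big)^{1/2}\big|_U$, and for a ball $B_r$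 of radius $r$, $1\le r\le R$, put $S_{B_r}f=\big(\sum_{\tau\in\mathbf S_{r^{-1/2}}}|f_\tau|^2\big)^{1/2}\big|_{B_r}$. Fix $M\in\mathbb N$. Let $S(r,R)\in[0,\infty]$ be the infimum of the constants $C\in[0,\infty]$ such that $$\sum_{B_r}|B_r|^{-1}\|S_{B_r}f\|_{L^2(B_r)}^4\le C\sum_{R^{-1/2}\le s\le1}\ \sum_{\tau\in\mathbf S_s}\ \sum_{U\parallel U_{\tau,R}}|U|^{-1}\|S_Uf\|_{L^2}^4$$ for every such $f$ and all choices as above. Here the first sum is over the balls of any cover of $\mathbb R^3$ by closed balls of radius $r$ for which every point lies in at most $M$ of the balls; $s$ runs over the dyadic numbers $2^{-k}$, $k\ge0$, in the given range; and $\sum_{U\parallel U_{\tau,R}}$ is over the members of any tiling of $\mathbb R^3$ by translates of $U_{\tau,R}$. *Claim.* There is a constant $C<\infty$, depending only on the overlap bound $M$, such that $$S(r_1,r^2)\le C\qquad\text{for all } r\ge10 \text{ and all } r_1\in[r,r^2].$$ -/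

import Mathlib

open MeasureTheory Set
open scoped ENNReal NNReal FourierTransform SchwartzMap

namespace ConeSq

noncomputable section

/-- Three-dimensional Euclidean space (coordinates `0, 1, 2` stand for `1, 2, 3`). -/
abbrev E3 : Type := EuclideanSpace ℝ (Fin 3)

/-- The truncated light cone. -/
def cone : Set E3 :=
  {ξ | ξ 0 ^ 2 + ξ 1 ^ 2 = ξ 2 ^ 2 ∧ 1 / 2 ≤ |ξ 2| ∧ |ξ 2| ≤ 1}

/-- The core direction at the point `(cos φ, sin φ, 1)` of the cone. -/
def coreDir (φ : ℝ) : E3 := !₂[Real.cos φ, Real.sin φ, 1]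

/-- The normal direction at the point `(cos φ, sin φ, 1)` of the cone. -/
def normalDir (φ : ℝ) : E3 := !₂[Real.cos φ, Real.sin φ, -1]

/-- The tangent direction at the point `(cos φ, sin φ, 1)` of the cone. -/
def tangentDir (φ : ℝ) : E3 := !₂[-Real.sin φ, Real.cos φ, 0]

/-- The sector with direction `(cos φ, sin φ, 1)` and aperture `s < 1`. -/
def sector (s φ : ℝ) : Set E3 :=
  {ω | 1 ≤ inner ℝ (coreDir φ) ω ∧ inner ℝ (coreDir φ) ω ≤ 2 ∧
    |inner ℝ (normalDir φ) ω| ≤ s ^ 2 ∧ |inner ℝ (tangentDir φ) ω| ≤ s}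

/-- The dilate of `sector s φ` by the factor `2` about its centroid, together with its reflection
in the origin. For `s² ≤ 1/4` these sets, over the directions used below, cover the full
`s²`-neighbourhood of both nappes of the truncated cone; they contain the sectors. -/
def fatSector (s φ : ℝ) : Set E3 :=
  {ω | 1 / 2 ≤ |inner ℝ (coreDir φ) ω| ∧ |inner ℝ (coreDir φ) ω| ≤ 5 / 2 ∧
    |inner ℝ (normalDir φ) ω| ≤ 2 * s ^ 2 ∧ |inner ℝ (tangentDir φ) ω| ≤ 2 * s}

/-- The number of sectors of aperture `s`: `10 / s`, rounded up, when `s < 1`, while at aperture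
`s = 1` a single sector accounts for the whole cone. -/
def numSectors (s : ℝ) : ℕ := if 0 < s ∧ s < 1 then ⌈10 / s⌉₊ else 1

/-- The evenly spaced directions of the sectors of aperture `s`. -/
def sectorAngle (s : ℝ) (j : Fin (numSectors s)) : ℝ := 2 * Real.pi * (j : ℝ) / (numSectors s : ℝ)

/-- The translate by `v` of the box `U_{τ,ρ}`, for `τ` of aperture `s` and direction `φ`. -/
def box (s φ ρ : ℝ) (v : E3) : Set E3 :=
  {x | |inner ℝ (coreDir φ) (x - v)| ≤ ρ * s ^ 2 ∧ |inner ℝ (normalDir φ) (x - v)| ≤ ρ ∧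
    |inner ℝ (tangentDir φ) (x - v)| ≤ ρ * s}

/-- The translates by `v ∈ V` of the box `U_{τ,ρ}` tile space: they cover it, and their interiors
are pairwise disjoint. -/
def IsBoxTiling (s φ ρ : ℝ) (V : Set E3) : Prop :=
  (⋃ v ∈ V, box s φ ρ v) = univ ∧ V.PairwiseDisjoint fun v => interior (box s φ ρ v)

/-- The closed balls of radius `r` with centres in `B` cover space, and every point lies in at most
`M` of them. -/
def IsBallCover (M : ℕ) (r : ℝ) (B : Set E3) : Prop :=
  (⋃ v ∈ B, Metric.closedBall v r) = univ ∧
    ∀ x : E3, {v ∈ B | x ∈ Metric.closedBall v r}.encard ≤ M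

/-- `f` is a function whose distributional Fourier transform is supported in the closed set `K`.
For compact `K`, any tempered distribution with this property is a smooth function of temperate
growth, so that asking for temperate growth is no restriction. -/
def FourierSupportedIn (f : E3 → ℂ) (K : Set E3) : Prop :=
  ∃ hf : Function.HasTemperateGrowth f,
    Distribution.dsupport (𝓕 (hf.toTemperedDistribution volume) : 𝓢'(E3, ℂ)) ⊆ K

/-- The finest sectors `θ` at scale `R`, those of aperture `R^{-1/2}`. -/
abbrev Fine (R : ℝ) : Type := Fin (numSectors (√R)⁻¹)

/-- A decomposition `f = ∑ f_θ` over the sectors of aperture `R^{-1/2}`, with the Fourier transform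
of `f_θ` supported near `θ`. -/
structure Decomposition (R : ℝ) (f : E3 → ℂ) where
  piece : Fine R → E3 → ℂ
  supported : ∀ j, FourierSupportedIn (piece j) (fatSector (√R)⁻¹ (sectorAngle (√R)⁻¹ j))
  sum_eq : ∀ x, f x = ∑ j, piece j x

/-- The meaning of `θ ⊂ τ`: for each aperture `s`, the finest sectors are distributed among the
sectors `τ` of aperture `s`, each `θ` going to one `τ` that it intersects. (At aperture `1` there is
only one `τ`, and it contains every `θ`.) -/
structure Nesting (R : ℝ) where
  parent : (s : ℝ) → Fine R → Fin (numSectors s)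
  meets : ∀ s, (√R)⁻¹ ≤ s → s < 1 → ∀ j : Fine R,
    (sector (√R)⁻¹ (sectorAngle (√R)⁻¹ j) ∩ sector s (sectorAngle s (parent s j))).Nonempty

/-- The sectors `θ ⊂ τ`, where `τ` is the `i`-th sector of aperture `s`. -/
def Nesting.children {R : ℝ} (A : Nesting R) (s : ℝ) (i : Fin (numSectors s)) : Finset (Fine R) :=
  Finset.univ.filter fun j => A.parent s j = i

/-- `f_τ = ∑_{θ ⊂ τ} f_θ`, where `τ` is the `i`-th sector of aperture `s`. -/
def coarsePiece {R : ℝ} {f : E3 → ℂ} (D : Decomposition R f) (A : Nesting R) (s : ℝ)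
    (i : Fin (numSectors s)) (x : E3) : ℂ :=
  ∑ j ∈ A.children s i, D.piece j x

/-- The square function `(∑_{θ ⊂ τ} |f_θ|²)^{1/2}` over the sectors `θ` of aperture `R^{-1/2}`; its
restriction to a translate `U` of `U_{τ,R}` is `S_U f`. -/
def boxSquareFunction {R : ℝ} {f : E3 → ℂ} (D : Decomposition R f) (A : Nesting R) (s : ℝ)
    (i : Fin (numSectors s)) (x : E3) : ℝ :=
  √(∑ j ∈ A.children s i, ‖D.piece j x‖ ^ 2)

/-- The square function over all sectors of aperture `r^{-1/2}`; its restriction to a ball `B_r` of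
radius `r` is `S_{B_r} f`. -/
def ballSquareFunction {R : ℝ} {f : E3 → ℂ} (D : Decomposition R f) (A : Nesting R) (r : ℝ)
    (x : E3) : ℝ :=
  √(∑ i : Fin (numSectors (√r)⁻¹), ‖coarsePiece D A (√r)⁻¹ i x‖ ^ 2)

/-- The dyadic numbers `s` with `R^{-1/2} ≤ s ≤ 1`. -/
def dyadicScales (R : ℝ) : Set ℝ :=
  {s | (∃ k : ℕ, s = (2 : ℝ)⁻¹ ^ k) ∧ (√R)⁻¹ ≤ s ∧ s ≤ 1}

/-- `∑_{B_r} |B_r|⁻¹ ‖S_{B_r} f‖_{L²(B_r)}⁴`. -/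
def ballSum {R : ℝ} {f : E3 → ℂ} (D : Decomposition R f) (A : Nesting R) (r : ℝ)
    (B : Set E3) : ℝ≥0∞ :=
  ∑' v : B, (volume (Metric.closedBall (v : E3) r))⁻¹ *
    eLpNorm (ballSquareFunction D A r) 2 (volume.restrict (Metric.closedBall (v : E3) r)) ^ 4

/-- `∑_s ∑_{τ ∈ S_s} ∑_{U ∥ U_{τ,R}} |U|⁻¹ ‖S_U f‖_{L²}⁴`. -/
def multiscaleSum {R : ℝ} {f : E3 → ℂ} (D : Decomposition R f) (A : Nesting R)
    (T : (s : ℝ) → Fin (numSectors s) → Set E3) : ℝ≥0∞ :=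
  ∑' s : dyadicScales R, ∑ i : Fin (numSectors (s : ℝ)), ∑' v : T s i,
    (volume (box s (sectorAngle s i) R v))⁻¹ *
      eLpNorm (boxSquareFunction D A s i) 2 (volume.restrict (box s (sectorAngle s i) R v)) ^ 4

/-- `C` is admissible for the pair of scales `(r, R)`: the inequality between the sum over balls and
the multiscale sum holds for every function with Fourier support in the `R⁻¹`-neighbourhood of the
cone, and for all choices that enter the two sums. -/
def IsAdmissible (M : ℕ) (r R : ℝ) (C : ℝ≥0∞) : Prop :=
  ∀ f : E3 → ℂ, FourierSupportedIn f (Metric.cthickening R⁻¹ cone) →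
    ∀ (D : Decomposition R f) (A : Nesting R) (B : Set E3), IsBallCover M r B →
      ∀ T : (s : ℝ) → Fin (numSectors s) → Set E3,
        (∀ s ∈ dyadicScales R, ∀ i, IsBoxTiling s (sectorAngle s i) R (T s i)) →
          ballSum D A r B ≤ C * multiscaleSum D A T

/-- The constant `S(r, R)`, with ball covers of overlap at most `M`; it is `∞` if there is no finite
admissible constant. -/
def S (M : ℕ) (r R : ℝ) : ℝ≥0∞ := sInf {C | IsAdmissible M r R C}

end

end ConeSq

/-! Write `R = r²`, `σ = R^{-1/2}`. Both sides are compared with `∫ (∑_θ |f_θ|²)²`.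

From balls to this integral (`exists_ballSum_le`): since `r₁ ≥ √R`, localising to a ball of radius
`r₁` blurs frequencies by at most `σ`, and the `σ`-neighbourhoods of the sectors `θ` overlap
boundedly (`card_fatSector_le`). Thus on each ball `∑_τ |f_τ|²` is controlled in mean by `∑_θ
|f_θ|²`, however the `θ` are grouped. Cauchy–Schwarz on the ball and bounded overlap of the balls
finish this half.

From the integral to the multiscale sum (`lintegral_square_sq_le_multiscaleSum`), by Plancherel: the
Fourier transform of `|f_θ|²` lives in a plank through the origin, of dimensions about `1 × σ² × σ`.
Let `ω` have horizontal part of polar coordinates `(ρ, α)`. Its plank conditions force `ρ cos(φ_θ -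
α) = ω₂ + O(σ²)`. If the unsigned angles `|φ_θ - α|` of the planks through `ω` spread over an
interval of length `w`, trigonometry gives `ρ w² ≲ σ²` and `ρ |sin(φ_θ - α)| w ≲ σ²`
(`spread_bounds`). With `s ~ max(w, σ)`, this places `ω` in a dilate of the dual of `U_{τ,R}` for
each relevant `τ` of aperture `s`, and there are boundedly many such `τ` (`exists_scale`). So at
each frequency a single scale and boundedly many `τ` matter. Finally, the `L²` norm on the dual of
`U` of the transform of `∑_{θ⊂τ} |f_θ|²` is controlled by averages over translates of `U`
(`lintegral_fourier_sq_le`). Summing over all scales costs nothing, since the right-hand side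
contains them all.

The `f_θ` are only of temperate growth. Multiplication by a band-limited Schwartz cutoff makes these
arguments legitimate with only a small enlargement of the Fourier supports. -/

namespace ConeSq

noncomputable section

/-! ### Fourier supports and band-limited cutoffs. -/

/-- A tempered distribution annihilates the compactly supported test functions whose support misses
its own. -/
theorem eq_zero_of_disjoint_dsupport (u : 𝓢'(E3, ℂ)) (h : 𝓢(E3, ℂ)) (hc : HasCompactSupport h)
    (hd : Disjoint (tsupport h) (Distribution.dsupport u)) : u h = 0 := by
  have hx : ∀ x ∈ tsupport h, ∃ s : Set E3, Distribution.IsVanishingOn u s ∧ IsOpen s ∧ x ∈ s :=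
    fun x hx => (Distribution.notMem_dsupport_iff x).1 (Set.disjoint_left.1 hd hx)
  choose! a ha ho hm using hx
  -- Finitely many vanishing neighbourhoods cover the support; a subordinate partition of unity cuts
  -- `h` into test functions each annihilated by `u`.
  obtain ⟨t, ht⟩ := hc.isCompact.elim_nhds_subcover' (fun x hx => a x)
    (fun x hx => (ho x hx).mem_nhds (hm x hx))
  obtain ⟨p, hp⟩ := SmoothPartitionOfUnity.exists_isSubordinate (modelWithCornersSelf ℝ E3)
    (isClosed_tsupport h) (fun x : t => a (x : tsupport h))
    (fun x => ho _ (x : tsupport h).2) (by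
      intro x hx
      have := ht hx
      simp only [mem_iUnion] at this ⊢
      obtain ⟨i, hi, hxi⟩ := this
      exact ⟨⟨i, hi⟩, hxi⟩)
  have hsm : ∀ i, ContDiff ℝ ((⊤ : ℕ∞) : WithTop ℕ∞) (fun x => ((p i x : ℝ) : ℂ) * h x) := fun i =>
    (Complex.ofRealCLM.contDiff.comp (p i).contMDiff.contDiff).mul (h.smooth ⊤)
  have hcs : ∀ i, HasCompactSupport (fun x => ((p i x : ℝ) : ℂ) * h x) := fun i => hc.mul_left
  have hsum : h = ∑ i, (hcs i).toSchwartzMap (hsm i) := by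
    ext x
    rw [sum_apply]
    simp only [HasCompactSupport.toSchwartzMap_toFun]
    rw [← Finset.sum_mul]
    by_cases hx : x ∈ tsupport h
    · have := p.sum_eq_one hx
      rw [finsum_eq_sum_of_fintype] at this
      rw [← Complex.ofReal_sum, this]; simp
    · rw [image_eq_zero_of_notMem_tsupport hx]; simp
  rw [hsum, map_sum]
  refine Finset.sum_eq_zero fun i _ => ha _ (i : tsupport h).2 _ ?_
  refine (closure_mono ?_).trans (hp i)
  intro x hx
  simp only [HasCompactSupport.toSchwartzMap_toFun, Function.mem_support, ne_eq, mul_eq_zero,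
    not_or, Complex.ofReal_eq_zero] at hx
  exact hx.1

theorem fourier_compSubConst (b : 𝓢(E3, ℂ)) (a x : E3) :
    𝓕 (b.compSubConstCLM ℂ a) x =
      Complex.exp (↑(-2 * Real.pi * inner ℝ a x) * Complex.I) * 𝓕 b x := by
  rw [SchwartzMap.fourier_coe, SchwartzMap.fourier_coe, Real.fourier_eq', Real.fourier_eq',
    ← integral_const_mul, ← integral_add_right_eq_self _ a]
  congr 1; ext y
  simp only [SchwartzMap.compSubConstCLM_apply, add_sub_cancel_right, smul_eq_mul, inner_add_left]
  rw [← mul_assoc, ← Complex.exp_add]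
  congr 2; push_cast; ring

/-- The Fourier transform of `f · 𝓕 b` lives within the support radius of `b` of the Fourier support
of `f`. -/
theorem FourierSupportedIn.exists_dist_le {f : E3 → ℂ} {K : Set E3} (hf : FourierSupportedIn f K)
    {b : 𝓢(E3, ℂ)} {ε : ℝ} (hb : tsupport b ⊆ Metric.closedBall 0 ε) {ξ : E3}
    (hξ : 𝓕 (SchwartzMap.smulLeftCLM ℂ f (𝓕 b)) ξ ≠ 0) : ∃ k ∈ K, dist ξ k ≤ ε := by
  obtain ⟨hf, hK⟩ := hf
  by_contra! hcon
  apply hξ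
  -- The value at `ξ` is the pairing of the distribution `𝓕 f` with `b(· - ξ)`, a test function
  -- supported in the `ε`-ball about `ξ`; `hcon` says that this ball misses `K`.
  have hts : tsupport (b.compSubConstCLM ℂ ξ) ⊆ Metric.closedBall ξ ε := by
    refine closure_minimal ?_ Metric.isClosed_closedBall
    intro x hx
    have : x - ξ ∈ Metric.closedBall (0 : E3) ε := hb (subset_tsupport _ hx)
    simpa [dist_eq_norm] using this
  have h0 := eq_zero_of_disjoint_dsupport (𝓕 (hf.toTemperedDistribution volume))
    (b.compSubConstCLM ℂ ξ)
    (HasCompactSupport.of_support_subset_isCompact (isCompact_closedBall ξ ε)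
      ((subset_tsupport _).trans hts))
    (Set.disjoint_left.2 fun x hx hx' => by
      have h1 := hts hx
      have h2 := hcon x (hK hx')
      rw [Metric.mem_closedBall, dist_comm] at h1
      linarith)
  have h1 := (Function.HasTemperateGrowth.toTemperedDistribution_apply volume hf
    (𝓕 (b.compSubConstCLM ℂ ξ))).symm.trans h0
  rw [SchwartzMap.fourier_coe, Real.fourier_eq', ← h1]
  congr 1; ext x
  rw [fourier_compSubConst, SchwartzMap.smulLeftCLM_apply_apply hf]
  simp only [smul_eq_mul, real_inner_comm]
  ring

/-- The squared modulus of a Schwartz function. -/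
def absSq (f : 𝓢(E3, ℂ)) : 𝓢(E3, ℂ) :=
  SchwartzMap.smulLeftCLM ℂ f (f.postcompCLM (Complex.conjCLE : ℂ →L[ℝ] ℂ))

theorem absSq_apply (f : 𝓢(E3, ℂ)) (x : E3) : absSq f x = ((‖f x‖ ^ 2 : ℝ) : ℂ) := by
  rw [absSq, SchwartzMap.smulLeftCLM_apply_apply f.hasTemperateGrowth]
  simp [Complex.mul_conj, Complex.normSq_eq_norm_sq]

/-- The Fourier support of `|f|²` lies in the difference set of the Fourier support of `f`. -/
theorem exists_of_fourier_absSq_ne_zero (f : 𝓢(E3, ℂ)) {ω : E3} (h : 𝓕 (absSq f) ω ≠ 0) :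
    ∃ ξ, 𝓕 f ξ ≠ 0 ∧ 𝓕 f (ξ - ω) ≠ 0 := by
  by_contra! hcon
  apply h
  set b : 𝓢(E3, ℂ) := 𝓕⁻ f with hb
  have hfb : 𝓕 b = f := by simp [hb]
  have hbx : ∀ x, b x = 𝓕 f (-x) := by
    intro x
    rw [hb, SchwartzMap.fourierInv_coe, SchwartzMap.fourier_coe, Real.fourierInv_eq_fourier_neg]
  -- Parseval for `b` and its translate by `-ω`: one side is `𝓕 (|f|²) ω`, the other correlates the
  -- values of `𝓕 f` at `ξ` and `ξ - ω`, with `ξ = -x`.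
  have key := SchwartzMap.integral_inner_fourier_fourier (b.compSubConstCLM ℂ (-ω)) b
  have h0 : ∀ x, inner ℂ (b.compSubConstCLM ℂ (-ω) x) (b x) = 0 := by
    intro x
    rw [SchwartzMap.compSubConstCLM_apply, hbx, hbx]
    by_cases hx : 𝓕 f (-x) = 0
    · rw [hx, inner_zero_right]
    · rw [show -(x - -ω) = -x - ω by abel, hcon _ hx, inner_zero_left]
  simp only [h0, integral_zero] at key
  rw [SchwartzMap.fourier_coe, Real.fourier_eq', ← key]
  congr 1; ext x
  rw [fourier_compSubConst, hfb, absSq_apply]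
  simp only [smul_eq_mul, RCLike.inner_apply, map_mul, ← Complex.exp_conj, inner_neg_left,
    Complex.conj_ofReal, Complex.conj_I, real_inner_comm]
  have : ((‖f x‖ ^ 2 : ℝ) : ℂ) = f x * (starRingEnd ℂ) (f x) := by
    rw [Complex.mul_conj, Complex.normSq_eq_norm_sq]
  rw [this]
  have h2 : (↑(-2 * Real.pi * -inner ℝ ω x) * -Complex.I : ℂ)
      = ↑(-2 * Real.pi * inner ℝ ω x) * Complex.I := by push_cast; ring
  rw [h2]; ring

theorem lintegral_enorm_sq_fourier (f : 𝓢(E3, ℂ)) :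
    ∫⁻ ξ, ‖𝓕 f ξ‖ₑ ^ 2 = ∫⁻ x, ‖f x‖ₑ ^ 2 := by
  have key : ∀ g : 𝓢(E3, ℂ), ∫⁻ x, ‖g x‖ₑ ^ 2 = ENNReal.ofReal (∫ x, ‖g x‖ ^ 2) := by
    intro g
    rw [ofReal_integral_eq_lintegral_ofReal]
    · congr 1; ext x
      rw [← ofReal_norm, ENNReal.ofReal_pow (norm_nonneg _)]
    · exact (g.memLp 2).integrable_norm_pow (by norm_num)
    · exact Filter.Eventually.of_forall fun x => by positivity
  rw [key, key, SchwartzMap.integral_norm_sq_fourier]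

/-- The Fourier transform of a nonnegative function is at least half of its integral at a frequency
whose phase on the support of the function is at most `1 / 6` of a turn. -/
theorem half_integral_le_norm_fourier {Φ : E3 → ℝ} (hi : Integrable Φ) (h0 : ∀ x, 0 ≤ Φ x) {ω : E3}
    (hs : ∀ x, Φ x ≠ 0 → |inner ℝ x ω| ≤ 1 / 6) :
    1 / 2 * ∫ x, Φ x ≤ ‖𝓕 (fun x => (Φ x : ℂ)) ω‖ := by
  refine le_trans ?_ (Complex.re_le_norm _)
  rw [Real.fourier_eq', ← RCLike.re_eq_complex_re, ← integral_re, ← integral_const_mul]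
  · have hre : ∀ x, RCLike.re (Complex.exp (↑(-2 * Real.pi * inner ℝ x ω) * Complex.I) • (Φ x : ℂ))
        = Real.cos (2 * Real.pi * inner ℝ x ω) * Φ x := by
      intro x
      rw [RCLike.re_eq_complex_re, smul_eq_mul, Complex.re_mul_ofReal,
        Complex.exp_ofReal_mul_I_re, ← Real.cos_neg]
      congr 2; ring
    simp only [hre]
    refine integral_mono (hi.const_mul _) ?_ fun x => ?_
    · refine hi.bdd_mul (c := 1) (by fun_prop) (Filter.Eventually.of_forall fun x => ?_)
      exact Real.abs_cos_le_one _
    · by_cases hx : Φ x = 0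
      · simp [hx]
      · refine mul_le_mul_of_nonneg_right ?_ (h0 x)
        have h1 := hs x hx
        rw [← Real.cos_abs, ← Real.cos_pi_div_three]
        have hpi := Real.pi_pos
        have h2 : |2 * Real.pi * inner ℝ x ω| ≤ Real.pi / 3 := by
          rw [abs_mul, abs_of_pos (by positivity)]
          nlinarith
        exact Real.cos_le_cos_of_nonneg_of_le_pi (abs_nonneg _) (by linarith) h2
  · refine (hi.ofReal (𝕜 := ℂ)).bdd_mul (c := 1) (by fun_prop)
      (Filter.Eventually.of_forall fun x => ?_)
    rw [Complex.norm_exp_ofReal_mul_I]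

/-- A Schwartz function `η`, of modulus comparable to `1` on the unit ball, all of whose rescaled
translates have compactly supported inverse Fourier transform. -/
theorem exists_bandlimited_cutoff : ∃ η : 𝓢(E3, ℂ), (∀ x, ‖η x‖ ≤ 1) ∧ η 0 = 1 ∧
    (∀ x, ‖x‖ ≤ 1 → 1 / 2 ≤ ‖η x‖) ∧ ∀ (v : E3) (ρ : ℝ), 0 < ρ → ∃ b : 𝓢(E3, ℂ),
      tsupport b ⊆ Metric.closedBall 0 ρ⁻¹ ∧ ∀ x, 𝓕 b x = η (ρ⁻¹ • (x - v)) := by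
  -- `η` will be the transform of this normalised bump. Outer radius `1 / 6` keeps the phase within
  -- a sixth of a turn on the unit ball, whence `1 / 2 ≤ ‖η‖` there.
  let β : ContDiffBump (0 : E3) := ⟨1 / 12, 1 / 6, by norm_num, by norm_num⟩
  have hβs : ContDiff ℝ ((⊤ : ℕ∞) : WithTop ℕ∞) (β.normed volume) := β.contDiff_normed
  have hβc : HasCompactSupport (β.normed volume) := β.hasCompactSupport_normed
  have hβi : Integrable (β.normed volume) := β.integrable_normed
  have hβ1 : ∫ x, β.normed volume x = 1 := β.integral_normed
  have hβ0 : ∀ x, 0 ≤ β.normed volume x := β.nonneg_normed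
  have hβt : ∀ x, β.normed volume x ≠ 0 → ‖x‖ ≤ 1 / 6 := by
    intro x hx
    have : x ∈ Function.support (β.normed volume) := hx
    rw [β.support_normed_eq] at this
    exact (mem_ball_zero_iff.1 this).le
  set g := β.normed volume
  have hgc : HasCompactSupport (fun x => (g x : ℂ)) :=
    hβc.comp_left (g := fun y : ℝ => (y : ℂ)) (by simp)
  have hgs : ContDiff ℝ ((⊤ : ℕ∞) : WithTop ℕ∞) (fun x => (g x : ℂ)) := Complex.ofRealCLM.contDiff.comp hβs
  let B : 𝓢(E3, ℂ) := hgc.toSchwartzMap hgs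
  have hB : ∀ x, 𝓕 B x = 𝓕 (fun x => (g x : ℂ)) x := fun x => rfl
  refine ⟨𝓕 B, fun x => ?_, ?_, fun x hx => ?_, fun v ρ hρ => ?_⟩
  · rw [hB, Real.fourier_eq']
    refine (norm_integral_le_integral_norm _).trans ?_
    rw [← hβ1]
    refine le_of_eq (integral_congr_ae (Filter.Eventually.of_forall fun y => ?_))
    simp only [norm_smul, Complex.norm_exp_ofReal_mul_I, one_mul, Complex.norm_real,
      Real.norm_of_nonneg (hβ0 y)]
  · rw [hB, Real.fourier_eq']
    simp only [inner_zero_right, mul_zero, Complex.ofReal_zero, zero_mul, Complex.exp_zero,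
      one_smul]
    rw [integral_complex_ofReal, hβ1]; simp
  · have := half_integral_le_norm_fourier hβi hβ0 (ω := x) (fun y hy => by
      refine (abs_real_inner_le_norm _ _).trans ?_
      nlinarith [hβt y hy, norm_nonneg x, norm_nonneg y])
    rw [hβ1, mul_one] at this
    exact this
  -- Dilating the bump by `ρ` on the frequency side rescales `η`; the modulation by `v` translates
  -- it.
  · let c : E3 → ℂ := fun ξ => ((ρ ^ 3 * g (ρ • ξ) : ℝ) : ℂ) *
      Complex.exp (↑(2 * Real.pi * inner ℝ v ξ) * Complex.I)
    have hsupp : Function.support c ⊆ Metric.closedBall 0 ρ⁻¹ := by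
      intro ξ hξ
      have h1 : g (ρ • ξ) ≠ 0 := by
        intro h; apply hξ; simp [c, h]
      have h2 := hβt _ h1
      rw [norm_smul, Real.norm_of_nonneg hρ.le] at h2
      rw [mem_closedBall_zero_iff, ← one_div, le_div_iff₀ hρ]
      linarith
    have hcc : HasCompactSupport c :=
      HasCompactSupport.of_support_subset_isCompact (isCompact_closedBall _ _) hsupp
    have hcs : ContDiff ℝ ((⊤ : ℕ∞) : WithTop ℕ∞) c := by
      refine ContDiff.mul ?_ ?_
      · refine Complex.ofRealCLM.contDiff.comp (contDiff_const.mul (hβs.comp ?_))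
        exact contDiff_id.const_smul ρ
      · refine Complex.contDiff_exp.comp (ContDiff.mul ?_ contDiff_const)
        exact Complex.ofRealCLM.contDiff.comp (contDiff_const.mul (contDiff_const.inner ℝ contDiff_id))
    refine ⟨hcc.toSchwartzMap hcs, closure_minimal hsupp Metric.isClosed_closedBall, fun x => ?_⟩
    have e1 : 𝓕 (hcc.toSchwartzMap hcs) x = 𝓕 c x := rfl
    rw [e1, hB, Real.fourier_eq', Real.fourier_eq']
    let F : E3 → ℂ := fun ζ =>
      Complex.exp (↑(-2 * Real.pi * inner ℝ ζ (ρ⁻¹ • (x - v))) * Complex.I) • (g ζ : ℂ)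
    have e2 : ∀ ξ, Complex.exp (↑(-2 * Real.pi * inner ℝ ξ x) * Complex.I) • c ξ =
        (ρ ^ 3 : ℂ) * F (ρ • ξ) := by
      intro ξ
      have : inner ℝ (ρ • ξ) (ρ⁻¹ • (x - v)) = inner ℝ ξ x - inner ℝ v ξ := by
        rw [real_inner_smul_left, real_inner_smul_right, ← mul_assoc, mul_inv_cancel₀ hρ.ne',
          one_mul, inner_sub_right, real_inner_comm v ξ]
      simp only [this, c, F, smul_eq_mul]
      have : Complex.exp (↑(-2 * Real.pi * (inner ℝ ξ x - inner ℝ v ξ)) * Complex.I) =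
          Complex.exp (↑(-2 * Real.pi * inner ℝ ξ x) * Complex.I) *
          Complex.exp (↑(2 * Real.pi * inner ℝ v ξ) * Complex.I) := by
        rw [← Complex.exp_add]; congr 1; push_cast; ring
      rw [this]; push_cast; ring
    simp only [e2]
    change _ = ∫ ζ, F ζ
    rw [integral_const_mul, Measure.integral_comp_smul, finrank_euclideanSpace_fin,
      abs_of_pos (by positivity), Complex.real_smul]
    rw [← mul_assoc]
    have : (ρ : ℂ) ≠ 0 := by exact_mod_cast hρ.ne'
    push_cast
    rw [mul_inv_cancel₀ (pow_ne_zero 3 this), one_mul]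

/-! ### Frame coordinates, and counting sectors by direction. -/

/-- The radial coordinate of `ω` in the frame with direction `φ`. -/
def radial (φ : ℝ) (ω : E3) : ℝ := Real.cos φ * ω 0 + Real.sin φ * ω 1

theorem inner_coreDir (φ : ℝ) (ω : E3) : inner ℝ (coreDir φ) ω = radial φ ω + ω 2 := by
  simp [coreDir, radial, PiLp.inner_apply, Fin.sum_univ_three]; ring

theorem inner_normalDir (φ : ℝ) (ω : E3) : inner ℝ (normalDir φ) ω = radial φ ω - ω 2 := by
  simp [normalDir, radial, PiLp.inner_apply, Fin.sum_univ_three]; ring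

theorem inner_tangentDir (φ : ℝ) (ω : E3) :
    inner ℝ (tangentDir φ) ω = -Real.sin φ * ω 0 + Real.cos φ * ω 1 := by
  simp [tangentDir, PiLp.inner_apply, Fin.sum_univ_three]; ring

/-- The radial and tangential coordinates are those of the horizontal part of `ω` in an orthonormal
basis of the plane, so a change of direction acts as a rotation by `β - φ`. -/
theorem radial_eq (φ β : ℝ) (ω : E3) : radial β ω =
    radial φ ω * Real.cos (β - φ) + inner ℝ (tangentDir φ) ω * Real.sin (β - φ) := by
  rw [inner_tangentDir, radial, radial, Real.cos_sub, Real.sin_sub]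
  linear_combination (-Real.cos β * ω 0 - Real.sin β * ω 1) * Real.sin_sq_add_cos_sq φ

theorem tangent_eq (φ β : ℝ) (ω : E3) : inner ℝ (tangentDir β) ω =
    inner ℝ (tangentDir φ) ω * Real.cos (β - φ) - radial φ ω * Real.sin (β - φ) := by
  rw [inner_tangentDir, inner_tangentDir, radial, Real.cos_sub, Real.sin_sub]
  linear_combination (Real.sin β * ω 0 - Real.cos β * ω 1) * Real.sin_sq_add_cos_sq φ

theorem radial_sq_add_tangent_sq_le (φ : ℝ) (ω : E3) :
    radial φ ω ^ 2 + inner ℝ (tangentDir φ) ω ^ 2 ≤ ‖ω‖ ^ 2 := by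
  rw [EuclideanSpace.real_norm_sq_eq, Fin.sum_univ_three, inner_tangentDir, radial]
  nlinarith [Real.sin_sq_add_cos_sq φ, sq_nonneg (ω 2)]

theorem abs_radial_le (φ : ℝ) (ω : E3) : |radial φ ω| ≤ ‖ω‖ :=
  abs_le_of_sq_le_sq (by
    nlinarith [radial_sq_add_tangent_sq_le φ ω, sq_nonneg (inner ℝ (tangentDir φ) ω)]) (norm_nonneg _)

theorem abs_tangent_le (φ : ℝ) (ω : E3) : |inner ℝ (tangentDir φ) ω| ≤ ‖ω‖ :=
  abs_le_of_sq_le_sq (by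
    nlinarith [radial_sq_add_tangent_sq_le φ ω, sq_nonneg (radial φ ω)]) (norm_nonneg _)

/-- Polar coordinates `(ρ, α)` of the horizontal part: every frame then sees `ω` only through `φ -
α`. -/
theorem exists_polar (ω : E3) : ∃ ρ α : ℝ, 0 ≤ ρ ∧ (∀ φ, radial φ ω = ρ * Real.cos (φ - α)) ∧
    ∀ φ, inner ℝ (tangentDir φ) ω = -(ρ * Real.sin (φ - α)) := by
  let z : ℂ := ⟨ω 0, ω 1⟩
  have h0 : ω 0 = ‖z‖ * Real.cos z.arg := (Complex.norm_mul_cos_arg z).symm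
  have h1 : ω 1 = ‖z‖ * Real.sin z.arg := (Complex.norm_mul_sin_arg z).symm
  refine ⟨‖z‖, z.arg, norm_nonneg _, fun φ => ?_, fun φ => ?_⟩
  · rw [radial, h0, h1, Real.cos_sub]; ring
  · rw [inner_tangentDir, h0, h1, Real.sin_sub]; ring

theorem exists_int_abs_sub_le_pi (δ : ℝ) : ∃ k : ℤ, |δ - 2 * Real.pi * k| ≤ Real.pi := by
  refine ⟨round (δ / (2 * Real.pi)), ?_⟩
  have h := abs_sub_round (δ / (2 * Real.pi))
  have hpi := Real.pi_pos
  have : δ - 2 * Real.pi * round (δ / (2 * Real.pi)) =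
      (2 * Real.pi) * (δ / (2 * Real.pi) - round (δ / (2 * Real.pi))) := by field_simp
  rw [this, abs_mul, abs_of_pos (by positivity)]
  nlinarith

theorem cos_sub_two_pi_mul (x : ℝ) (k : ℤ) : Real.cos (x - 2 * Real.pi * k) = Real.cos x := by
  rw [mul_comm]; exact Real.cos_sub_int_mul_two_pi x k

theorem sin_sub_two_pi_mul (x : ℝ) (k : ℤ) : Real.sin (x - 2 * Real.pi * k) = Real.sin x := by
  rw [mul_comm]; exact Real.sin_sub_int_mul_two_pi x k

/-- An angle whose cosine is close to `1` is close to a multiple of `2π`. -/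
theorem exists_int_abs_sub_le {δ m : ℝ} (hm : 0 ≤ m) (h : 1 - Real.cos δ ≤ m ^ 2) :
    ∃ k : ℤ, |δ - 2 * Real.pi * k| ≤ 3 * m := by
  obtain ⟨k, hk⟩ := exists_int_abs_sub_le_pi δ
  refine ⟨k, abs_le_of_sq_le_sq ?_ (by positivity)⟩
  have h1 := Real.cos_le_one_sub_mul_cos_sq hk
  rw [cos_sub_two_pi_mul] at h1
  set x := δ - 2 * Real.pi * k
  have hpi := Real.pi_pos
  have h2 : 2 / Real.pi ^ 2 * x ^ 2 ≤ m ^ 2 := by linarith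
  rw [div_mul_eq_mul_div, div_le_iff₀ (by positivity)] at h2
  have h3 : Real.pi ^ 2 ≤ 16 := by nlinarith [Real.pi_le_four]
  nlinarith [sq_nonneg m, Real.pi_lt_d2]

/-- At most `N w / π + 1` of `N` evenly spaced angles lie within `w` of a given angle. -/
theorem card_angles_le {N : ℕ} (hN : 0 < N) (γ w : ℝ) (s : Finset (Fin N))
    (hw : 0 ≤ w) (hs : ∀ i ∈ s, ∃ k : ℤ, |2 * Real.pi * (i : ℝ) / N - γ - 2 * Real.pi * k| ≤ w) :
    (s.card : ℝ) ≤ N * w / Real.pi + 1 := by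
  choose! k hk using hs
  have hpi := Real.pi_pos
  have hN' : (0 : ℝ) < N := by exact_mod_cast hN
  set x := γ * N / (2 * Real.pi)
  set y := w * N / (2 * Real.pi)
  have hy : 0 ≤ y := by positivity
  -- In units of the step `2π / N`, the index shifted by the winding number lies in `[x - y, x +
  -- y]`. Reduction mod `N` recovers the index, so the map is injective.
  have hcard : s.card ≤ (Finset.Icc ⌈x - y⌉ ⌊x + y⌋).card := by
    refine Finset.card_le_card_of_injOn (fun i => (i : ℤ) - k i * N) ?_ ?_
    · intro i hi
      have h1 := abs_le.1 (hk i hi)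
      have e : 2 * Real.pi * (i : ℝ) / N - γ - 2 * Real.pi * k i =
        (2 * Real.pi / N) * ((i : ℝ) - k i * N - x) := by
        simp only [x]; field_simp; ring
      have e2 : w = (2 * Real.pi / N) * y := by simp only [y]; field_simp
      rw [e, e2] at h1
      have hp : 0 < 2 * Real.pi / N := by positivity
      have l1 : -y ≤ (i : ℝ) - k i * N - x := by
        by_contra! hh; nlinarith [h1.1]
      have l2 := le_of_mul_le_mul_left h1.2 hp
      simp only [Finset.coe_Icc, Set.mem_Icc, Int.ceil_le, Int.le_floor]
      push_cast
      constructor <;> linarith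
    · intro i hi j hj hij
      simp only at hij
      have hd : (N : ℤ) ∣ (i : ℤ) - (j : ℤ) := ⟨k i - k j, by linarith⟩
      have := Int.eq_zero_of_abs_lt_dvd hd (by
        have := i.2; have := j.2; rw [abs_lt]; constructor <;> omega)
      ext; omega
  have hz : (0 : ℝ) ≤ N * w / Real.pi + 1 := by positivity
  rw [Int.card_Icc] at hcard
  have h3 : ((⌊x + y⌋ + 1 - ⌈x - y⌉).toNat : ℝ) ≤ N * w / Real.pi + 1 := by
    have e : N * w / Real.pi = 2 * y := by simp only [y]; field_simp
    rcases le_total 0 (⌊x + y⌋ + 1 - ⌈x - y⌉) with h | h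
    · have : ((⌊x + y⌋ + 1 - ⌈x - y⌉).toNat : ℝ) = ((⌊x + y⌋ + 1 - ⌈x - y⌉ : ℤ) : ℝ) := by
        exact_mod_cast congrArg (fun z : ℤ => (z : ℝ)) (Int.toNat_of_nonneg h)
      rw [this, e]
      push_cast
      linarith [Int.floor_le (x + y), Int.le_ceil (x - y)]
    · rw [Int.toNat_of_nonpos h]; simpa using hz
  exact le_trans (by exact_mod_cast hcard) h3

theorem numSectors_pos (s : ℝ) : 0 < numSectors s := by
  unfold numSectors
  split_ifs with h
  · exact Nat.ceil_pos.2 (div_pos (by norm_num) h.1)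
  · exact one_pos

theorem numSectors_le {s : ℝ} (h0 : 0 < s) (h1 : s < 1) : (numSectors s : ℝ) ≤ 11 / s := by
  rw [numSectors, if_pos ⟨h0, h1⟩]
  have h2 := (Nat.ceil_lt_add_one (show 0 ≤ 10 / s by positivity)).le
  have h3 : 1 ≤ 1 / s := by rw [le_div_iff₀ h0]; linarith
  have : 11 / s = 10 / s + 1 / s := by rw [← add_div]; norm_num
  linarith

/-- There are at most `11 / s` directions, so the count is at most `11 c / π + 1`. -/
theorem card_sectors_le {s : ℝ} (h0 : 0 < s) (h1 : s < 1) (γ : ℝ) {c : ℝ} (hc : 0 ≤ c)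
    (t : Finset (Fin (numSectors s)))
    (ht : ∀ i ∈ t, ∃ k : ℤ, |sectorAngle s i - γ - 2 * Real.pi * k| ≤ c * s) :
    (t.card : ℝ) ≤ 4 * c + 1 := by
  refine (card_angles_le (numSectors_pos s) γ (c * s) t (by positivity) ht).trans ?_
  have h2 : (numSectors s : ℝ) * (c * s) ≤ 11 * c := by
    have := mul_le_mul_of_nonneg_right (numSectors_le h0 h1) (show 0 ≤ c * s by positivity)
    refine this.trans (le_of_eq ?_)
    field_simp
  have h3 := Real.pi_gt_three
  have h4 : (numSectors s : ℝ) * (c * s) / Real.pi ≤ 4 * c := by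
    rw [div_le_iff₀ Real.pi_pos]
    nlinarith
  linarith

/-- Two windows are needed because fat sectors lie on both nappes (directions `α` and `α + π`), and
because a cosine determines its angle only up to sign. -/
theorem card_sectors_le_of_or {s : ℝ} (h0 : 0 < s) (h1 : s < 1) (γ γ' : ℝ) {c : ℝ} (hc : 0 ≤ c)
    (t : Finset (Fin (numSectors s)))
    (ht : ∀ i ∈ t, (∃ k : ℤ, |sectorAngle s i - γ - 2 * Real.pi * k| ≤ c * s) ∨
      ∃ k : ℤ, |sectorAngle s i - γ' - 2 * Real.pi * k| ≤ c * s) :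
    (t.card : ℝ) ≤ 8 * c + 2 := by
  classical
  have hsub : t ⊆
      t.filter (fun i => ∃ k : ℤ, |sectorAngle s i - γ - 2 * Real.pi * k| ≤ c * s) ∪
      t.filter (fun i => ∃ k : ℤ, |sectorAngle s i - γ' - 2 * Real.pi * k| ≤ c * s) := by
    intro i hi
    simp only [Finset.mem_union, Finset.mem_filter, hi, true_and]
    exact ht i hi
  have hcard : (t.card : ℝ) ≤ _ :=
    Nat.cast_le.2 ((Finset.card_le_card hsub).trans (Finset.card_union_le _ _))
  push_cast at hcard
  have e1 := card_sectors_le h0 h1 γ hc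
    (t.filter (fun i => ∃ k : ℤ, |sectorAngle s i - γ - 2 * Real.pi * k| ≤ c * s))
    (fun i hi => (Finset.mem_filter.1 hi).2)
  have e2 := card_sectors_le h0 h1 γ' hc
    (t.filter (fun i => ∃ k : ℤ, |sectorAngle s i - γ' - 2 * Real.pi * k| ≤ c * s))
    (fun i hi => (Finset.mem_filter.1 hi).2)
  linarith

/-- The `σ`-neighbourhoods of the fat sectors of aperture `σ` have bounded overlap. -/
theorem card_fatSector_le {σ : ℝ} (h0 : 0 < σ) (h1 : σ ≤ 1 / 10) (ω : E3)
    (t : Finset (Fin (numSectors σ)))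
    (ht : ∀ i ∈ t, ∃ k ∈ fatSector σ (sectorAngle σ i), dist ω k ≤ σ) :
    (t.card : ℝ) ≤ 530 := by
  obtain ⟨ρ, α, hρ, hrad, htan⟩ := exists_polar ω
  -- A nearby point of the fat sector has radial part at least `6 / 25`, so `ω` has radial part at
  -- least `7 / 50` and tangential part at most `3 σ`. Hence `|sin (φ - α)| ≤ 22 σ`, and `φ` is
  -- within `66 σ` of `α` or of `α + π`, according to the sign of the cosine; `530 = 8 * 66 + 2`.
  have key : ∀ i ∈ t, (∃ k : ℤ, |sectorAngle σ i - α - 2 * Real.pi * k| ≤ 66 * σ) ∨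
      ∃ k : ℤ, |sectorAngle σ i - (α + Real.pi) - 2 * Real.pi * k| ≤ 66 * σ := by
    intro i hi
    obtain ⟨k, ⟨hc1, hc2, hn, htg⟩, hk⟩ := ht i hi
    set φ := sectorAngle σ i
    rw [inner_coreDir] at hc1
    rw [inner_normalDir] at hn
    have hka : 6 / 25 ≤ |radial φ k| := by
      have h2 : |radial φ k + k 2| ≤ 2 * |radial φ k| + |radial φ k - k 2| := by
        have : radial φ k + k 2 = 2 * radial φ k - (radial φ k - k 2) := by ring
        rw [this]
        refine (abs_sub _ _).trans ?_
        rw [abs_mul, abs_two]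
      nlinarith
    have hd : ‖ω - k‖ ≤ σ := by rwa [← dist_eq_norm]
    have hra : |radial φ ω - radial φ k| ≤ σ := by
      refine le_trans (le_of_eq ?_) ((abs_radial_le φ (ω - k)).trans hd)
      congr 1; simp [radial]; ring
    have hta : |inner ℝ (tangentDir φ) ω - inner ℝ (tangentDir φ) k| ≤ σ := by
      rw [← inner_sub_right]; exact (abs_tangent_le φ (ω - k)).trans hd
    have ha : 7 / 50 ≤ |radial φ ω| := by
      have := abs_sub_abs_le_abs_sub (radial φ k) (radial φ ω)
      rw [abs_sub_comm] at this
      linarith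
    have hb : |inner ℝ (tangentDir φ) ω| ≤ 3 * σ := by
      have := abs_sub_abs_le_abs_sub (inner ℝ (tangentDir φ) ω) (inner ℝ (tangentDir φ) k)
      linarith
    rw [hrad, abs_mul, abs_of_nonneg hρ] at ha
    rw [htan, abs_neg, abs_mul, abs_of_nonneg hρ] at hb
    have hρ' : 7 / 50 ≤ ρ := by nlinarith [Real.abs_cos_le_one (φ - α)]
    have hs : |Real.sin (φ - α)| ≤ 22 * σ := by nlinarith [abs_nonneg (Real.sin (φ - α))]
    have hs2 : Real.sin (φ - α) ^ 2 ≤ (22 * σ) ^ 2 := by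
      rw [← sq_abs]; exact pow_le_pow_left₀ (abs_nonneg _) hs 2
    have hsc := Real.sin_sq_add_cos_sq (φ - α)
    rcases le_total 0 (Real.cos (φ - α)) with hcs | hcs
    · left
      obtain ⟨m, hm⟩ := exists_int_abs_sub_le (δ := φ - α) (m := 22 * σ) (by positivity)
        (by nlinarith [Real.cos_le_one (φ - α)])
      exact ⟨m, by linarith⟩
    · right
      have e : Real.cos (φ - (α + Real.pi)) = -Real.cos (φ - α) := by
        rw [← sub_sub, Real.cos_sub_pi]
      obtain ⟨m, hm⟩ := exists_int_abs_sub_le (δ := φ - (α + Real.pi)) (m := 22 * σ) (by positivity)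
        (by rw [e]; nlinarith [Real.neg_one_le_cos (φ - α)])
      exact ⟨m, by linarith⟩
  have := card_sectors_le_of_or h0 (by linarith) α (α + Real.pi) (by norm_num : (0 : ℝ) ≤ 66) t key
  linarith

/-- Sectors that meet have close directions. -/
theorem angle_close_of_meets {σ s φ β : ℝ} (h0 : 0 < σ) (h1 : σ ≤ 1 / 10) (hs : σ ≤ s)
    (hs1 : s ≤ 1 / 2) (h : (sector σ φ ∩ sector s β).Nonempty) :
    |Real.sin (β - φ)| ≤ 6 * s ∧ 1 - Real.cos (β - φ) ≤ 36 * s ^ 2 := by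
  obtain ⟨ω, ⟨a1, -, a3, a4⟩, b1, -, b3, b4⟩ := h
  rw [inner_coreDir] at a1 b1
  rw [inner_normalDir] at a3 b3
  have hr := radial_eq φ β ω
  have ht := tangent_eq φ β ω
  set a := radial φ ω
  set a' := radial β ω
  set b := inner ℝ (tangentDir φ) ω
  set b' := inner ℝ (tangentDir β) ω
  set S := Real.sin (β - φ)
  set C := Real.cos (β - φ)
  have hSC : S ^ 2 + C ^ 2 = 1 := Real.sin_sq_add_cos_sq _
  have hC : |C| ≤ 1 := Real.abs_cos_le_one _
  rw [abs_le] at a3 b3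
  have ha : 99 / 200 ≤ a := by nlinarith
  have ha' : 3 / 8 ≤ a' := by nlinarith
  have hS : |S| ≤ 6 * s := by
    have e : a * S = b * C - b' := by linarith
    have e2 : |a * S| ≤ σ + s := by
      rw [e]
      refine (abs_sub _ _).trans (add_le_add ?_ b4)
      rw [abs_mul]
      nlinarith [abs_nonneg b, abs_nonneg C]
    rw [abs_mul, abs_of_pos (by linarith)] at e2
    nlinarith [abs_nonneg S]
  refine ⟨hS, ?_⟩
  have hS2 : S ^ 2 ≤ (6 * s) ^ 2 := by
    rw [← sq_abs]; exact pow_le_pow_left₀ (abs_nonneg _) hS 2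
  -- A small sine also allows opposite directions. These are excluded because the common point has
  -- large positive radial part in both frames. Then `1 - C ≤ 1 - C² = S²`.
  have hCpos : 0 < C := by
    have e : a * a' + b * b' = C * (a ^ 2 + b ^ 2) := by rw [hr, ht]; ring
    have e1 : |b * b'| ≤ 1 / 10 * (1 / 2) := by
      rw [abs_mul]
      exact mul_le_mul (a4.trans h1) (b4.trans hs1) (abs_nonneg _) (by norm_num)
    rw [abs_le] at e1
    have e2 : 0 < C * (a ^ 2 + b ^ 2) := by nlinarith
    exact pos_of_mul_pos_left e2 (by positivity)
  have : C ≤ 1 := (le_abs_self _).trans hC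
  nlinarith

/-! ### Planks, dual boxes and the choice of scale. -/

/-- If `ρ cos` varies by at most `16 σ²` between the angles `ψ₀ ≤ ψ₁`, then the spread `ψ₁ - ψ₀`
controls `ρ`, and `ρ sin ψ` for the angles `ψ` in between. -/
theorem spread_bounds {ρ σ ψ₀ ψ₁ ψ : ℝ} (hρ : 0 ≤ ρ) (h0 : 0 ≤ ψ₀) (h01 : ψ₀ ≤ ψ) (h12 : ψ ≤ ψ₁)
    (hpi : ψ₁ ≤ Real.pi) (h : ρ * (Real.cos ψ₀ - Real.cos ψ₁) ≤ 16 * σ ^ 2) :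
    ρ * (ψ₁ - ψ₀) ^ 2 ≤ 128 * σ ^ 2 ∧ ρ * Real.sin ψ * (ψ₁ - ψ₀) ≤ 96 * σ ^ 2 := by
  set u := (ψ₀ + ψ₁) / 2 with hu
  set w := (ψ₁ - ψ₀) / 2 with hw
  have hw0 : 0 ≤ w := by rw [hw]; linarith
  -- The cosine difference is a product in the midpoint `u` and the half-spread `w`. Since `w ≤ u ≤
  -- π - w`, both sines are at least `w / 2`; this bounds `ρ sin u · w` and then `ρ w²`. Any `ψ` in
  -- between satisfies `sin ψ ≤ sin u + w`.
  have hcos : Real.cos ψ₀ - Real.cos ψ₁ = 2 * Real.sin u * Real.sin w := by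
    have e0 : ψ₀ = u - w := by rw [hu, hw]; ring
    have e1 : ψ₁ = u + w := by rw [hu, hw]; ring
    rw [e0, e1, Real.cos_sub, Real.cos_add]; ring
  have hpi0 := Real.pi_pos
  have hsw : w / 2 ≤ Real.sin w := by
    have h1 := Real.mul_le_sin hw0 (by rw [hw]; linarith)
    refine le_trans ?_ h1
    have h2 : (1 : ℝ) / 2 ≤ 2 / Real.pi := by
      rw [div_le_div_iff₀ (by norm_num) hpi0]; linarith [Real.pi_le_four]
    nlinarith
  have hsu : Real.sin w ≤ Real.sin u := by
    have e : Real.sin u - Real.sin w = 2 * Real.sin ((u - w) / 2) * Real.cos ((u + w) / 2) :=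
      Real.sin_sub_sin u w
    have n1 : 0 ≤ Real.sin ((u - w) / 2) :=
      Real.sin_nonneg_of_nonneg_of_le_pi (by rw [hu, hw]; linarith) (by rw [hu, hw]; linarith)
    have n2 : 0 ≤ Real.cos ((u + w) / 2) :=
      Real.cos_nonneg_of_neg_pi_div_two_le_of_le (by rw [hu, hw]; linarith)
        (by rw [hu, hw]; linarith)
    nlinarith [mul_nonneg n1 n2]
  have hsψ : Real.sin ψ ≤ Real.sin u + w := by
    have e : Real.sin ψ - Real.sin u = 2 * Real.sin ((ψ - u) / 2) * Real.cos ((ψ + u) / 2) :=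
      Real.sin_sub_sin ψ u
    have n1 : |Real.sin ((ψ - u) / 2)| ≤ w / 2 := by
      refine (Real.abs_sin_le_abs).trans ?_
      rw [abs_le, hu, hw]; constructor <;> linarith
    have n2 := Real.abs_cos_le_one ((ψ + u) / 2)
    have n3 : |Real.sin ψ - Real.sin u| ≤ w := by
      rw [e, abs_mul, abs_mul, abs_two]
      nlinarith [abs_nonneg (Real.sin ((ψ - u) / 2)), abs_nonneg (Real.cos ((ψ + u) / 2))]
    linarith [le_abs_self (Real.sin ψ - Real.sin u)]
  rw [hcos] at h
  have hspread : ψ₁ - ψ₀ = 2 * w := by rw [hw]; ring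
  rw [hspread]
  have k1 : ρ * Real.sin u * w ≤ 16 * σ ^ 2 := by
    have : 0 ≤ ρ * Real.sin u := mul_nonneg hρ (by linarith)
    nlinarith
  have k2 : ρ * w ^ 2 ≤ 32 * σ ^ 2 := by
    have : ρ * (w / 2 * w) ≤ ρ * (Real.sin u * w) :=
      mul_le_mul_of_nonneg_left (mul_le_mul_of_nonneg_right (by linarith) hw0) hρ
    nlinarith
  constructor
  · nlinarith
  · have : ρ * Real.sin ψ * w ≤ ρ * (Real.sin u + w) * w :=
      mul_le_mul_of_nonneg_right (mul_le_mul_of_nonneg_left hsψ hρ) hw0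
    nlinarith

/-- A plank through the origin that contains the differences of points near `sector σ φ`. -/
def plank (σ φ : ℝ) : Set E3 :=
  {ω | |inner ℝ (coreDir φ) ω| ≤ 8 ∧ |inner ℝ (normalDir φ) ω| ≤ 8 * σ ^ 2 ∧
    |inner ℝ (tangentDir φ) ω| ≤ 8 * σ}

/-- The dilate by the factor `C` of the dual of the box `U_{τ,R}`, for `τ` of aperture `s` and
direction `φ`, with `R = σ⁻²`. -/
def dualBox (C σ s φ : ℝ) : Set E3 :=
  {ω | |inner ℝ (coreDir φ) ω| * s ^ 2 ≤ C * σ ^ 2 ∧ |inner ℝ (normalDir φ) ω| ≤ C * σ ^ 2 ∧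
    |inner ℝ (tangentDir φ) ω| * s ≤ C * σ ^ 2}

/-- Turning the frame by `O(s)` changes the normal coordinate by `O(ρ s² + b s)`, where `b` is the
tangential coordinate in the frame `φ`, and the tangential one by `O(ρ s + b)`. The hypotheses make
these errors `O(σ²)` and `O(σ² / s)`, as the dual box allows; `40000` is a generous constant. -/
theorem mem_dualBox_of_close {σ s φ β ρ α : ℝ} {ω : E3} (hs : 0 < s) (hs1 : s ≤ 1) (hρ : 0 ≤ ρ)
    (hrad : ∀ φ, radial φ ω = ρ * Real.cos (φ - α))
    (hρs : ρ * s ^ 2 ≤ 512 * σ ^ 2) (hω : ω ∈ plank σ φ)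
    (hts : |inner ℝ (tangentDir φ) ω| * s ≤ 512 * σ ^ 2)
    (hsin : |Real.sin (β - φ)| ≤ 6 * s) (hcos : 1 - Real.cos (β - φ) ≤ 36 * s ^ 2) :
    ω ∈ dualBox 40000 σ s β := by
  obtain ⟨-, hn, -⟩ := hω
  rw [inner_normalDir] at hn
  have hr := radial_eq φ β ω
  have ht := tangent_eq φ β ω
  have ha : |radial φ ω| ≤ ρ := by
    rw [hrad, abs_mul, abs_of_nonneg hρ]
    exact mul_le_of_le_one_right hρ (Real.abs_cos_le_one _)
  have ha' : |radial β ω| ≤ ρ := by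
    rw [hrad, abs_mul, abs_of_nonneg hρ]
    exact mul_le_of_le_one_right hρ (Real.abs_cos_le_one _)
  have hC1 : |Real.cos (β - φ)| ≤ 1 := Real.abs_cos_le_one _
  have hC0 : 0 ≤ 1 - Real.cos (β - φ) := by linarith [Real.cos_le_one (β - φ)]
  set a := radial φ ω
  set a' := radial β ω
  set b := inner ℝ (tangentDir φ) ω
  set S := Real.sin (β - φ)
  set C := Real.cos (β - φ)
  have hσ := sq_nonneg σ
  have hn' : |a' - ω 2| ≤ 30000 * σ ^ 2 := by
    have e : a' - ω 2 = (a - ω 2) - a * (1 - C) + b * S := by rw [hr]; ring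
    have e1 : |a * (1 - C)| ≤ 36 * (512 * σ ^ 2) := by
      rw [abs_mul, abs_of_nonneg hC0]
      calc |a| * (1 - C) ≤ ρ * (36 * s ^ 2) := mul_le_mul ha hcos hC0 hρ
        _ = 36 * (ρ * s ^ 2) := by ring
        _ ≤ _ := by linarith
    have e2 : |b * S| ≤ 6 * (512 * σ ^ 2) := by
      rw [abs_mul]
      calc |b| * |S| ≤ |b| * (6 * s) := mul_le_mul_of_nonneg_left hsin (abs_nonneg _)
        _ = 6 * (|b| * s) := by ring
        _ ≤ _ := by linarith
    rw [e]
    have e3 := abs_add_le ((a - ω 2) - a * (1 - C)) (b * S)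
    have e4 := abs_sub (a - ω 2) (a * (1 - C))
    linarith
  refine ⟨?_, ?_, ?_⟩
  · rw [inner_coreDir]
    have e : |a' + ω 2| ≤ 2 * ρ + 30000 * σ ^ 2 := by
      have : a' + ω 2 = 2 * a' - (a' - ω 2) := by ring
      rw [this]
      refine (abs_sub _ _).trans ?_
      rw [abs_mul, abs_two]; linarith
    have hs2 : s ^ 2 ≤ 1 := by nlinarith
    calc |a' + ω 2| * s ^ 2 ≤ (2 * ρ + 30000 * σ ^ 2) * s ^ 2 :=
          mul_le_mul_of_nonneg_right e (sq_nonneg s)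
      _ = 2 * (ρ * s ^ 2) + 30000 * σ ^ 2 * s ^ 2 := by ring
      _ ≤ 2 * (512 * σ ^ 2) + 30000 * σ ^ 2 * 1 := by gcongr
      _ ≤ _ := by linarith
  · rw [inner_normalDir]; linarith
  · rw [ht]
    have e1 : |a * S| * s ≤ 6 * (512 * σ ^ 2) := by
      rw [abs_mul]
      calc |a| * |S| * s ≤ ρ * (6 * s) * s := by gcongr
        _ = 6 * (ρ * s ^ 2) := by ring
        _ ≤ _ := by linarith
    have e2 : |b * C| * s ≤ 512 * σ ^ 2 := by
      rw [abs_mul]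
      calc |b| * |C| * s ≤ |b| * 1 * s := by gcongr
        _ ≤ _ := by linarith
    have e3 := mul_le_mul_of_nonneg_right (abs_sub (b * C) (a * S)) hs.le
    rw [add_mul] at e3
    linarith

theorem inv_sqrt_bounds {R : ℝ} (hR : 100 ≤ R) :
    0 < (√R)⁻¹ ∧ (√R)⁻¹ ≤ 1 / 10 ∧ ((√R)⁻¹) ^ 2 = R⁻¹ := by
  have hsq : 10 ≤ √R := by
    rw [show (10 : ℝ) = √(10 ^ 2) by rw [Real.sqrt_sq (by norm_num)]]
    exact Real.sqrt_le_sqrt (by linarith)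
  refine ⟨by positivity, ?_, by rw [inv_pow, Real.sq_sqrt (by linarith)]⟩
  rw [inv_eq_one_div]; exact one_div_le_one_div_of_le (by norm_num) hsq

/-- At every frequency `ω` there is a dyadic scale `s` such that the planks through `ω` belong to
boundedly many sectors `τ` of aperture `s`, each with `ω` in a dilate of the dual of `U_{τ,R}`. -/
theorem exists_scale {R : ℝ} (hR : 100 ≤ R) (A : Nesting R) (ω : E3) :
    ∃ s ∈ dyadicScales R, ∃ t : Finset (Fin (numSectors s)), t.card ≤ 154 ∧
      ∀ i, ∀ j ∈ A.children s i, ω ∈ plank (√R)⁻¹ (sectorAngle (√R)⁻¹ j) →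
        i ∈ t ∧ ω ∈ dualBox 40000 (√R)⁻¹ s (sectorAngle s i) := by
  classical
  have hmeets := A.meets
  obtain ⟨hσ0, hσ1, -⟩ := inv_sqrt_bounds hR
  obtain ⟨ρ, α, hρ, hrad, htan⟩ := exists_polar ω
  let φ : Fine R → ℝ := fun j => sectorAngle (√R)⁻¹ j
  -- `ψ j ∈ [0, π]` is the unsigned angle between the direction of the `j`-th plank and `α`.
  choose k hk using fun j : Fine R => exists_int_abs_sub_le_pi (φ j - α)
  let ψ : Fine R → ℝ := fun j => |φ j - α - 2 * Real.pi * k j|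
  have hcosψ : ∀ j, Real.cos (ψ j) = Real.cos (φ j - α) := fun j => by
    rw [Real.cos_abs, cos_sub_two_pi_mul]
  have hsinψ : ∀ j, |Real.sin (φ j - α)| = Real.sin (ψ j) := fun j => by
    rw [← sin_sub_two_pi_mul _ (k j), ← abs_of_nonneg
      (Real.sin_nonneg_of_nonneg_of_le_pi (abs_nonneg _) (hk j) : 0 ≤ Real.sin (ψ j))]
    rcases abs_choice (φ j - α - 2 * Real.pi * k j) with h | h <;> simp only [ψ, h, Real.sin_neg,
      abs_neg]
  let J : Finset (Fine R) := Finset.univ.filter fun j => ω ∈ plank (√R)⁻¹ (φ j)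
  rcases J.eq_empty_or_nonempty with hJ | hJ
  · refine ⟨1, ⟨⟨0, by simp⟩, by linarith, le_rfl⟩, ∅, by simp, fun i j _ hj => ?_⟩
    have : j ∈ J := by simp [J]; exact hj
    rw [hJ] at this
    simp at this
  obtain ⟨j₀, hj₀, hmin⟩ := J.exists_min_image ψ hJ
  obtain ⟨j₁, hj₁, hmax⟩ := J.exists_max_image ψ hJ
  set σ := (√R)⁻¹
  have hplank : ∀ j ∈ J, ω ∈ plank σ (φ j) := fun j hj => (Finset.mem_filter.1 hj).2
  set w := ψ j₁ - ψ j₀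
  have hw0 : 0 ≤ w := sub_nonneg.2 (hmin j₁ hj₁)
  -- In every plank through `ω` the normal coordinate `ρ cos ψ - ω 2` is at most `8 σ²` in size;
  -- subtracting two of them eliminates `ω 2`.
  have hspread : ρ * (Real.cos (ψ j₀) - Real.cos (ψ j₁)) ≤ 16 * σ ^ 2 := by
    have e0 := (hplank j₀ hj₀).2.1
    have e1 := (hplank j₁ hj₁).2.1
    rw [inner_normalDir, hrad, abs_le] at e0 e1
    rw [hcosψ, hcosψ]
    linarith [e0.2, e1.1]
  have hb := fun j hj => spread_bounds hρ (abs_nonneg _ : 0 ≤ ψ j₀) (hmin j hj) (hmax j hj)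
    (hk j₁) hspread
  have htanψ : ∀ j, |inner ℝ (tangentDir (φ j)) ω| = ρ * Real.sin (ψ j) := fun j => by
    rw [htan, abs_neg, abs_mul, abs_of_nonneg hρ, hsinψ]
  -- The scale is the dyadic number just above the angular spread `w`, kept between `σ` and `1`.
  obtain ⟨n, hn1, hn2⟩ := exists_nat_pow_near_of_lt_one
    (lt_min one_pos (lt_max_of_lt_right hσ0) : 0 < min 1 (max w σ)) (min_le_left _ _)
    (by norm_num : (0 : ℝ) < 2⁻¹) (by norm_num)
  set s : ℝ := 2⁻¹ ^ n with hs
  have hs0 : 0 < s := by positivity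
  have hs1 : s ≤ 1 := pow_le_one₀ (by norm_num) (by norm_num)
  have hs2 : s ≤ 2 * max w σ := by
    rw [pow_succ] at hn1
    have := min_le_right 1 (max w σ)
    linarith
  have hσs : σ ≤ s := le_trans (le_min (by linarith) (le_max_right _ _)) hn2
  -- If `w ≤ σ`, then `s ≤ 2 σ` and the dimensions of one plank suffice. Otherwise `s ≤ 2 w`, and
  -- the spread bounds apply.
  have hρs : ρ * s ^ 2 ≤ 512 * σ ^ 2 ∧
      ∀ j ∈ J, |inner ℝ (tangentDir (φ j)) ω| * s ≤ 512 * σ ^ 2 := by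
    rcases le_total w σ with h | h
    · rw [max_eq_right h] at hs2
      have hρ16 : ρ ≤ 16 := by
        obtain ⟨c1, c2, c3⟩ := hplank j₀ hj₀
        rw [inner_coreDir, hrad] at c1
        rw [inner_normalDir, hrad] at c2
        rw [htan] at c3
        have hσ2 : σ ^ 2 ≤ 1 / 100 := by nlinarith
        have d1 : (ρ * Real.cos (φ j₀ - α)) ^ 2 ≤ 8 ^ 2 := by
          apply sq_le_sq'
          all_goals rw [abs_le] at c1 c2; linarith [c1.1, c1.2, c2.1, c2.2]
        have d2 : (ρ * Real.sin (φ j₀ - α)) ^ 2 ≤ 8 ^ 2 := by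
          apply sq_le_sq'
          all_goals rw [abs_le] at c3; linarith [c3.1, c3.2]
        have d3 := Real.sin_sq_add_cos_sq (φ j₀ - α)
        have d4 : ρ ^ 2 ≤ 16 ^ 2 := by
          have : ρ ^ 2 = (ρ * Real.cos (φ j₀ - α)) ^ 2 + (ρ * Real.sin (φ j₀ - α)) ^ 2 := by
            linear_combination (-ρ ^ 2) * d3
          linarith
        exact le_of_sq_le_sq d4 (by norm_num)
      have hs4 : s ^ 2 ≤ 4 * σ ^ 2 := by nlinarith
      refine ⟨by nlinarith [sq_nonneg s], fun j hj => ?_⟩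
      have c3 := (hplank j hj).2.2
      nlinarith [abs_nonneg (inner ℝ (tangentDir (φ j)) ω)]
    · rw [max_eq_left h] at hs2
      have hs4 : s ^ 2 ≤ 4 * w ^ 2 := by nlinarith
      refine ⟨?_, fun j hj => ?_⟩
      · have := mul_le_mul_of_nonneg_left hs4 hρ
        linarith [(hb j₀ hj₀).1]
      · have c := (hb j hj).2
        rw [htanψ]
        have c0 : 0 ≤ ρ * Real.sin (ψ j) := by rw [← htanψ]; exact abs_nonneg _
        have := mul_le_mul_of_nonneg_left hs2 c0
        nlinarith [sq_nonneg σ]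
  have hsd : s ∈ dyadicScales R := ⟨⟨n, rfl⟩, hσs, hs1⟩
  have hshalf : s < 1 → s ≤ 1 / 2 := by
    intro h
    have hn0 : n ≠ 0 := by rintro rfl; simp [hs] at h
    calc s ≤ 2⁻¹ ^ 1 := pow_le_pow_of_le_one (by norm_num) (by norm_num)
          (Nat.one_le_iff_ne_zero.2 hn0)
      _ = 1 / 2 := by norm_num
  have hclose : ∀ j, |Real.sin (sectorAngle s (A.parent s j) - φ j)| ≤ 6 * s ∧
      1 - Real.cos (sectorAngle s (A.parent s j) - φ j) ≤ 36 * s ^ 2 := by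
    intro j
    rcases lt_or_eq_of_le hs1 with h | h
    · exact angle_close_of_meets hσ0 hσ1 hσs (hshalf h) (hmeets s hσs h j)
    -- At `s = 1` there is no intersection condition, but the bounds `6` and `36` hold for any two
    -- angles.
    · exact ⟨by linarith [Real.abs_sin_le_one (sectorAngle s (A.parent s j) - φ j)],
        by nlinarith [Real.neg_one_le_cos (sectorAngle s (A.parent s j) - φ j)]⟩
  refine ⟨s, hsd, J.image (A.parent s), ?_, fun i j hj hjω => ?_⟩
  · rcases lt_or_eq_of_le hs1 with h | h
    · have hws : w ≤ s := by
        have : min 1 (max w σ) < 1 := lt_of_le_of_lt hn2 h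
        rw [min_eq_right (by by_contra! hh; rw [min_eq_left hh.le] at this; linarith)] at hn2
        exact (le_max_left _ _).trans hn2
      -- The parent's direction is within `18 s` of `φ j = α ± ψ j` modulo `2π`, and `ψ j` is within
      -- `w ≤ s` of `ψ j₀`, giving two windows of half-width `19 s` and the count `154 = 8 * 19 +
      -- 2`.
      have := card_sectors_le_of_or hs0 h (α + ψ j₀) (α - ψ j₀) (by norm_num : (0 : ℝ) ≤ 19)
        (J.image (A.parent s)) (by
          intro i hi
          obtain ⟨j, hj, rfl⟩ := Finset.mem_image.1 hi
          obtain ⟨m, hm⟩ := exists_int_abs_sub_le (m := 6 * s) (by positivity)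
            ((hclose j).2.trans_eq (by ring))
          rw [abs_le] at hm
          have m1 := hmin j hj
          have m2 := hmax j hj
          have hψj : ψ j = |φ j - α - 2 * Real.pi * k j| := rfl
          rcases le_total 0 (φ j - α - 2 * Real.pi * k j) with hh | hh
          · left
            rw [abs_of_nonneg hh] at hψj
            refine ⟨m + k j, ?_⟩
            push_cast
            rw [abs_le]
            constructor <;> linarith [hm.1, hm.2]
          · right
            rw [abs_of_nonpos hh] at hψj
            refine ⟨m + k j, ?_⟩
            push_cast
            rw [abs_le]
            constructor <;> linarith [hm.1, hm.2])
      norm_num at this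
      exact_mod_cast this
    · refine (Finset.card_le_univ _).trans ?_
      rw [Fintype.card_fin, h]
      simp [numSectors]
  · have hjJ : j ∈ J := Finset.mem_filter.2 ⟨Finset.mem_univ _, hjω⟩
    have hp : A.parent s j = i := (Finset.mem_filter.1 hj).2
    refine ⟨Finset.mem_image.2 ⟨j, hjJ, hp⟩, ?_⟩
    rw [← hp]
    exact mem_dualBox_of_close hs0 hs1 hρ hrad hρs.1 (hplank j hjJ) (hρs.2 j hjJ) (hclose j).1
      (hclose j).2

/-! ### A local `L²` estimate over tilings by a convex body. -/

open scoped Pointwise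

/-- Weighted Cauchy–Schwarz: expand the square and apply `2 a_i a_j ≤ a_i² + a_j²` termwise, which
remains valid for infinite values. -/
theorem tsum_mul_sq_le {ι : Type*} (w a : ι → ℝ≥0∞) :
    (∑' i, w i * a i) ^ 2 ≤ (∑' i, w i) * ∑' i, w i * a i ^ 2 := by
  have amgm : ∀ x y : ℝ≥0∞, 2 * (x * y) ≤ x ^ 2 + y ^ 2 := by
    intro x y
    rcases eq_or_ne x ⊤ with rfl | hx
    · simp
    rcases eq_or_ne y ⊤ with rfl | hy
    · simp
    lift x to ℝ≥0 using hx
    lift y to ℝ≥0 using hy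
    norm_cast
    rw [← mul_assoc]
    exact two_mul_le_add_sq x y
  have h1 : 2 * (∑' i, w i * a i) ^ 2 ≤ 2 * ((∑' i, w i) * ∑' i, w i * a i ^ 2) := by
    calc 2 * (∑' i, w i * a i) ^ 2
        = ∑' i, ∑' j, w i * w j * (2 * (a i * a j)) := by
          rw [sq, ← ENNReal.tsum_mul_right, ← ENNReal.tsum_mul_left]
          congr 1; ext i
          rw [← ENNReal.tsum_mul_left, ← ENNReal.tsum_mul_left]
          congr 1; ext j; ring
      _ ≤ ∑' i, ∑' j, w i * w j * (a i ^ 2 + a j ^ 2) := by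
          gcongr with i j; exact amgm _ _
      _ = ∑' i, ∑' j, (w i * a i ^ 2 * w j + w i * (w j * a j ^ 2)) := by
          congr 1; ext i; congr 1; ext j; ring
      _ = 2 * ((∑' i, w i) * ∑' i, w i * a i ^ 2) := by
          simp_rw [ENNReal.tsum_add, ENNReal.tsum_mul_left, ENNReal.tsum_mul_right]
          ring
  exact (ENNReal.mul_le_mul_iff_right (by norm_num) (by norm_num)).1 h1

/-- A symmetric convex body. -/
structure IsSymmConvexBody (U : Set E3) : Prop where
  convex : Convex ℝ U
  symm : ∀ x ∈ U, -x ∈ U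
  isClosed : IsClosed U
  bounded : Bornology.IsBounded U
  zero_mem : 0 ∈ interior U

theorem volume_translate (U : Set E3) (v : E3) : volume {x | x - v ∈ U} = volume U := by
  simp only [sub_eq_add_neg]
  exact measure_preimage_add_right volume (-v) U

theorem volume_smul (U : Set E3) {c : ℝ} (h0 : 0 ≤ c) :
    volume (c • U) = ENNReal.ofReal (c ^ 3) * volume U := by
  rw [Measure.addHaar_smul_of_nonneg _ h0, finrank_euclideanSpace_fin]

namespace IsSymmConvexBody

theorem measure_ne_zero {U : Set E3} (hU : IsSymmConvexBody U) : volume U ≠ 0 :=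
  (Measure.measure_pos_of_mem_nhds volume (mem_interior_iff_mem_nhds.1 hU.zero_mem)).ne'

theorem measure_ne_top {U : Set E3} (hU : IsSymmConvexBody U) : volume U ≠ ⊤ := hU.bounded.measure_lt_top.ne

theorem smul_subset {U : Set E3} (hU : IsSymmConvexBody U) {c : ℝ} (h0 : 0 ≤ c) (h1 : c ≤ 1) : c • U ⊆ U := by
  rintro _ ⟨x, hx, rfl⟩
  exact hU.convex.smul_mem_of_zero_mem (interior_subset hU.zero_mem) hx ⟨h0, h1⟩

theorem isClosed_smul {U : Set E3} (hU : IsSymmConvexBody U) (c : ℝ) : IsClosed (c • U) :=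
  ((Metric.isCompact_of_isClosed_isBounded hU.isClosed hU.bounded).smul c).isClosed

theorem half_smul_subset_interior {U : Set E3} (hU : IsSymmConvexBody U) {c : ℝ} (hc : 0 < c) : (c / 2) • U ⊆ interior (c • U) := by
  rw [interior_smul₀ hc.ne']
  rintro _ ⟨x, hx, rfl⟩
  have h : (1 / 2 : ℝ) • (0 : E3) + (1 / 2 : ℝ) • x ∈ interior U :=
    hU.convex.combo_interior_self_mem_interior hU.zero_mem hx (by norm_num) (by norm_num)
      (by norm_num)
  refine ⟨_, h, ?_⟩
  simp only [smul_zero, zero_add, smul_smul]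
  congr 1; ring

/-- A smooth bump adapted to the body `c • U`. -/
theorem exists_bump {U : Set E3} (hU : IsSymmConvexBody U) {c : ℝ} (hc : 0 < c) :
    ∃ Φ : 𝓢(E3, ℂ), ∃ p : E3 → ℝ, (∀ x, Φ x = p x) ∧
    (∀ x, 0 ≤ p x) ∧ (∀ x, p x ≤ 1) ∧ (∀ x, p x ≠ 0 → x ∈ c • U) ∧ Integrable p ∧
    (c / 2) ^ 3 * (volume U).toReal ≤ ∫ x, p x := by
  obtain ⟨p, hp1, hp0, hp⟩ := exists_contMDiffMap_one_nhds_of_subset_interior (n := ⊤)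
    (modelWithCornersSelf ℝ E3) (hU.isClosed_smul (c / 2)) (hU.half_smul_subset_interior hc)
  have hcpt : IsCompact (c • U) :=
    (Metric.isCompact_of_isClosed_isBounded hU.isClosed hU.bounded).smul c
  have hpc : HasCompactSupport p := HasCompactSupport.of_support_subset_isCompact hcpt fun x hx => by
    by_contra h; exact hx (hp0 x h)
  have hps : ContDiff ℝ ((⊤ : ℕ∞) : WithTop ℕ∞) p := p.contMDiff.contDiff
  have hcc : HasCompactSupport (fun x => (p x : ℂ)) :=
    hpc.comp_left (g := fun y : ℝ => (y : ℂ)) (by simp)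
  have hcs : ContDiff ℝ ((⊤ : ℕ∞) : WithTop ℕ∞) (fun x => (p x : ℂ)) :=
    Complex.ofRealCLM.contDiff.comp hps
  have hpi : Integrable p := hps.continuous.integrable_of_hasCompactSupport hpc
  refine ⟨hcc.toSchwartzMap hcs, p, fun x => rfl, fun x => (hp x).1, fun x => (hp x).2,
    fun x hx => by by_contra h; exact hx (hp0 x h), hpi, ?_⟩
  have hm : MeasurableSet ((c / 2) • U) := (hU.isClosed_smul _).measurableSet
  have hv : (volume ((c / 2) • U)).toReal = (c / 2) ^ 3 * (volume U).toReal := by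
    rw [volume_smul _ (by positivity), ENNReal.toReal_mul, ENNReal.toReal_ofReal (by positivity)]
  have hfin : volume ((c / 2) • U) ≠ ⊤ := by
    rw [volume_smul _ (by positivity)]
    exact ENNReal.mul_ne_top ENNReal.ofReal_ne_top hU.measure_ne_top
  rw [← hv]
  calc (volume ((c / 2) • U)).toReal = ∫ x, ((c / 2) • U).indicator (fun _ => (1 : ℝ)) x := by
        rw [integral_indicator hm]; simp [Measure.real]
    _ ≤ ∫ x, p x := by
        refine integral_mono ((integrable_indicator_iff hm).2
          (integrableOn_const hfin)) hpi fun x => ?_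
        refine Set.indicator_le' (fun y hy => ?_) (fun y _ => (hp y).1) x
        exact (hp1.self_of_nhdsSet y hy).ge

theorem measurableSet_translate {U : Set E3} (hU : IsSymmConvexBody U) (v : E3) : MeasurableSet {x | x - v ∈ U} :=
  hU.isClosed.measurableSet.preimage (measurable_id.sub_const v)

theorem measure_interior_translate {U : Set E3} (hU : IsSymmConvexBody U) (v : E3) : volume (interior {x | x - v ∈ U}) = volume U := by
  have e : {x | x - v ∈ U} = (Homeomorph.subRight v) ⁻¹' U := rfl
  rw [e, ← Homeomorph.preimage_interior]
  exact (volume_translate _ v).trans <|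
    measure_interior_of_null_frontier (hU.convex.addHaar_frontier volume)

/-- At most `27` tiles come near a given point. -/
theorem tsum_indicator_le {U : Set E3} (hU : IsSymmConvexBody U) {V : Set E3} [Countable V]
    (hd : V.PairwiseDisjoint fun v => interior {x | x - v ∈ U}) (x : E3) :
    ∑' v : V, {y | y - (v : E3) ∈ (2 : ℝ) • U}.indicator (fun _ => (1 : ℝ≥0∞)) x ≤ 27 := by
  classical
  have key : (∑' v : V, {y | y - (v : E3) ∈ (2 : ℝ) • U}.indicator (fun _ => (1 : ℝ≥0∞)) x) *
      volume U ≤ 27 * volume U := by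
    -- Packing: the tiles with `x` in their doubles have disjoint interiors inside `x + 3U`, of
    -- volume `27 |U|`.
    let S : V → Set E3 := fun v =>
      if x - (v : E3) ∈ (2 : ℝ) • U then interior {y | y - (v : E3) ∈ U} else ∅
    have hS : ∀ v : V, {y | y - (v : E3) ∈ (2 : ℝ) • U}.indicator (fun _ => (1 : ℝ≥0∞)) x *
        volume U = volume (S v) := by
      intro v
      by_cases h : x - (v : E3) ∈ (2 : ℝ) • U
      · rw [Set.indicator_of_mem (by exact h), one_mul]
        simp only [S, if_pos h, hU.measure_interior_translate]
      · rw [Set.indicator_of_notMem (by exact h), zero_mul]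
        simp only [S, if_neg h, measure_empty]
    rw [← ENNReal.tsum_mul_right]
    simp_rw [hS]
    rw [← measure_iUnion]
    · have hsub : ⋃ v, S v ⊆ {y | y - x ∈ (3 : ℝ) • U} := by
        intro y hy
        obtain ⟨v, hv⟩ := Set.mem_iUnion.1 hy
        simp only [S] at hv
        split_ifs at hv with h
        · have h1 : y ∈ {y | y - (v : E3) ∈ U} := interior_subset hv
          obtain ⟨u, hu, hu'⟩ := h
          refine ⟨(1 / 3 : ℝ) • (y - (v : E3)) + (2 / 3 : ℝ) • (-u),
            hU.convex h1 (hU.symm u hu) (by norm_num) (by norm_num) (by norm_num), ?_⟩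
          have hu2 : (2 : ℝ) • u = x - v := hu'
          simp only [smul_add, smul_smul, smul_neg]
          norm_num
          rw [hu2]; abel
        · exact hv.elim
      refine (measure_mono hsub).trans ?_
      rw [volume_translate, volume_smul _ (by norm_num)]
      norm_num
    · intro v w hvw
      have h := hd v.2 w.2 (fun h => hvw (Subtype.ext h))
      refine h.mono ?_ ?_ <;>
      · simp only [S]
        split_ifs
        · exact le_rfl
        · exact Set.empty_subset _
    · intro v
      simp only [S]
      split_ifs
      · exact isOpen_interior.measurableSet
      · exact MeasurableSet.empty
  exact (ENNReal.mul_le_mul_iff_left hU.measure_ne_zero hU.measure_ne_top).1 key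

theorem countable_tiles {U : Set E3} (hU : IsSymmConvexBody U) {V : Set E3}
    (hd : V.PairwiseDisjoint fun v => interior {x | x - v ∈ U}) : V.Countable := by
  refine hd.countable_of_isOpen (fun v _ => isOpen_interior) fun v _ => ?_
  exact nonempty_of_measure_ne_zero ((hU.measure_interior_translate v).trans_ne hU.measure_ne_zero)

/-- The average over a small translate of `U` is controlled by the integrals over the tiles. -/
theorem lintegral_near_le {U : Set E3} (hU : IsSymmConvexBody U) {V : Set E3} [Countable V]
    (hcov : ∀ x, ∃ v ∈ V, x - v ∈ U) {c : ℝ} (hc0 : 0 ≤ c) (hc1 : c ≤ 1) {W : E3 → ℝ≥0∞}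
    (hW : Measurable W) (x : E3) :
    ∫⁻ t, (c • U).indicator (fun _ => 1) (x - t) * W t ≤
      ∑' v : V, {y | y - (v : E3) ∈ (2 : ℝ) • U}.indicator (fun _ => (1 : ℝ≥0∞)) x *
        ∫⁻ t in {t | t - (v : E3) ∈ U}, W t := by
  have e : ∀ v : V, {y | y - (v : E3) ∈ (2 : ℝ) • U}.indicator (fun _ => (1 : ℝ≥0∞)) x *
        ∫⁻ t in {t | t - (v : E3) ∈ U}, W t =
      ∫⁻ t, {y | y - (v : E3) ∈ (2 : ℝ) • U}.indicator (fun _ => (1 : ℝ≥0∞)) x *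
        {t | t - (v : E3) ∈ U}.indicator W t := by
    intro v
    rw [lintegral_const_mul _ (hW.indicator (hU.measurableSet_translate v)),
      lintegral_indicator (hU.measurableSet_translate v)]
  simp_rw [e]
  rw [← lintegral_tsum fun v : V =>
    ((hW.indicator (hU.measurableSet_translate v)).const_mul _).aemeasurable]
  refine lintegral_mono fun t => ?_
  by_cases ht : x - t ∈ c • U
  · rw [Set.indicator_of_mem ht, one_mul]
    obtain ⟨v, hv, hvt⟩ := hcov t
    refine le_trans ?_ (ENNReal.le_tsum (⟨v, hv⟩ : V))
    have h1 : x ∈ {y | y - v ∈ (2 : ℝ) • U} := by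
      refine ⟨(1 / 2 : ℝ) • (x - t) + (1 / 2 : ℝ) • (t - v),
        hU.convex (hU.smul_subset hc0 hc1 ht) hvt (by norm_num) (by norm_num) (by norm_num), ?_⟩
      simp only [smul_add, smul_smul]
      norm_num
    rw [Set.indicator_of_mem h1, Set.indicator_of_mem (show t ∈ {t | t - v ∈ U} from hvt), one_mul]
  · rw [Set.indicator_of_notMem ht, zero_mul]; exact zero_le

/-- At most `27` doubled tiles contain `x`, so Cauchy–Schwarz squares the pointwise bound with loss
`27`. Integration in `x` gives each tile the volume `8 |U|` of its double; `216 = 27 * 8`. -/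
theorem lintegral_near_sq_le {U : Set E3} (hU : IsSymmConvexBody U) {V : Set E3}
    (hcov : ∀ x, ∃ v ∈ V, x - v ∈ U)
    (hd : V.PairwiseDisjoint fun v => interior {x | x - v ∈ U}) {c : ℝ} (hc0 : 0 ≤ c) (hc1 : c ≤ 1)
    {W : E3 → ℝ≥0∞} (hW : Measurable W) :
    ∫⁻ x, (∫⁻ t, (c • U).indicator (fun _ => 1) (x - t) * W t) ^ 2 ≤
      216 * volume U * ∑' v : V, (∫⁻ t in {t | t - (v : E3) ∈ U}, W t) ^ 2 := by
  have : Countable V := (hU.countable_tiles hd).to_subtype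
  have hm : ∀ v : E3, MeasurableSet {y | y - v ∈ (2 : ℝ) • U} := fun v =>
    (hU.isClosed_smul 2).measurableSet.preimage (measurable_id.sub_const v)
  calc ∫⁻ x, (∫⁻ t, (c • U).indicator (fun _ => 1) (x - t) * W t) ^ 2
      ≤ ∫⁻ x, 27 * ∑' v : V, {y | y - (v : E3) ∈ (2 : ℝ) • U}.indicator (fun _ => (1 : ℝ≥0∞)) x *
        (∫⁻ t in {t | t - (v : E3) ∈ U}, W t) ^ 2 := by
        refine lintegral_mono fun x => ?_
        refine (pow_le_pow_left' (hU.lintegral_near_le hcov hc0 hc1 hW x) 2).trans ?_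
        refine (tsum_mul_sq_le _ _).trans ?_
        gcongr
        exact hU.tsum_indicator_le hd x
    _ = 27 * ∑' v : V, ∫⁻ x, {y | y - (v : E3) ∈ (2 : ℝ) • U}.indicator
          (fun _ => (1 : ℝ≥0∞)) x * (∫⁻ t in {t | t - (v : E3) ∈ U}, W t) ^ 2 := by
        have hm' : ∀ v : V, Measurable fun x => {y | y - (v : E3) ∈ (2 : ℝ) • U}.indicator
          (fun _ => (1 : ℝ≥0∞)) x * (∫⁻ t in {t | t - (v : E3) ∈ U}, W t) ^ 2 := fun v =>
          (measurable_const.indicator (hm v)).mul_const _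
        rw [lintegral_const_mul _ (Measurable.tsum hm'),
          lintegral_tsum fun v => (hm' v).aemeasurable]
    _ = 216 * volume U * ∑' v : V, (∫⁻ t in {t | t - (v : E3) ∈ U}, W t) ^ 2 := by
        have e : ∀ v : V, ∫⁻ x, {y | y - (v : E3) ∈ (2 : ℝ) • U}.indicator
            (fun _ => (1 : ℝ≥0∞)) x * (∫⁻ t in {t | t - (v : E3) ∈ U}, W t) ^ 2 =
            8 * volume U * (∫⁻ t in {t | t - (v : E3) ∈ U}, W t) ^ 2 := by
          intro v
          rw [lintegral_mul_const _ (measurable_const.indicator (hm v)),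
            lintegral_indicator (hm v), setLIntegral_const, one_mul, volume_translate,
            volume_smul _ (by norm_num)]
          norm_num
        simp_rw [e, ENNReal.tsum_mul_left]
        ring

/-- If `D` lies in the dual body of `U`, up to the factor `C`, then the `L²` norm on `D` of the
Fourier transform of a nonnegative function is controlled by its integrals over the translates of
`U` in a tiling. -/
theorem lintegral_fourier_sq_le {U : Set E3} (hU : IsSymmConvexBody U) {V : Set E3}
    (hcov : ∀ x, ∃ v ∈ V, x - v ∈ U)
    (hd : V.PairwiseDisjoint fun v => interior {x | x - v ∈ U}) {C : ℝ} (hC : 1 ≤ C) {D : Set E3}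
    (hD : MeasurableSet D) (hDU : ∀ ω ∈ D, ∀ x ∈ U, |inner ℝ x ω| ≤ C) (G : 𝓢(E3, ℂ)) :
    ∫⁻ ω in D, ‖𝓕 G ω‖ₑ ^ 2 ≤ ENNReal.ofReal (864 * (12 * C) ^ 6) *
      ∑' v : V, (volume U)⁻¹ * (∫⁻ t in {t | t - (v : E3) ∈ U}, ‖G t‖ₑ) ^ 2 := by
  -- With this dilation the phase on the support of the bump is at most a sixth of a turn for `ω ∈
  -- D`, so `|𝓕 Φ| ≥ κ` on `D`.
  set c : ℝ := (6 * C)⁻¹ with hc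
  have hc0 : 0 < c := by positivity
  have hc1 : c ≤ 1 := inv_le_one_of_one_le₀ (by linarith)
  obtain ⟨Φ, p, hΦ, hp0, hp1, hps, hpi, hint⟩ := hU.exists_bump hc0
  have hU0 := hU.measure_ne_zero
  have hUt := hU.measure_ne_top
  set κ : ℝ≥0∞ := ENNReal.ofReal (1 / 2 * (c / 2) ^ 3) * volume U with hκ
  have hlow : ∀ ω ∈ D, κ ≤ ‖𝓕 Φ ω‖ₑ := by
    intro ω hω
    have h1 := half_integral_le_norm_fourier hpi hp0 (ω := ω) fun x hx => by
      obtain ⟨u, hu, rfl⟩ := hps x hx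
      have := hDU ω hω u hu
      simp only [inner_smul_left, RCLike.conj_to_real, abs_mul, abs_of_pos hc0]
      calc c * |inner ℝ u ω| ≤ c * C := mul_le_mul_of_nonneg_left this hc0.le
        _ = 1 / 6 := by rw [hc]; field_simp
    have h2 : 𝓕 Φ ω = 𝓕 (fun x => (p x : ℂ)) ω := by
      rw [SchwartzMap.fourier_coe, show (Φ : E3 → ℂ) = fun x => (p x : ℂ) from funext hΦ]
    rw [h2, ← ofReal_norm, hκ, ← ENNReal.ofReal_toReal hUt,
      ← ENNReal.ofReal_mul (by positivity)]
    exact ENNReal.ofReal_le_ofReal (by linarith)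
  -- On `D` the transform of `G` is at most `κ⁻¹` times that of `G * Φ`; after Plancherel, `G * Φ`
  -- is dominated by integrals of `|G|` over small translates of `U`.
  let H : 𝓢(E3, ℂ) := SchwartzMap.convolution (ContinuousLinearMap.mul ℂ ℂ) G Φ
  have hH : ∀ ω, 𝓕 H ω = 𝓕 G ω * 𝓕 Φ ω := by
    intro ω
    simp only [H, SchwartzMap.fourier_convolution, SchwartzMap.pairing_apply_apply,
      ContinuousLinearMap.mul_apply']
  have hHx : ∀ x, ‖H x‖ₑ ≤ ∫⁻ t, (c • U).indicator (fun _ => 1) (x - t) * ‖G t‖ₑ := by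
    intro x
    simp only [H, SchwartzMap.convolution_apply, convolution_def]
    refine (enorm_integral_le_lintegral_enorm _).trans (lintegral_mono fun t => ?_)
    simp only [ContinuousLinearMap.mul_apply', enorm_mul]
    rw [mul_comm]
    gcongr
    by_cases h : p (x - t) = 0
    · simp [hΦ, h]
    · rw [Set.indicator_of_mem (hps _ h), hΦ, ← ofReal_norm, Complex.norm_real,
        Real.norm_of_nonneg (hp0 _)]
      exact ENNReal.ofReal_le_one.2 (hp1 _)
  have hmain : κ ^ 2 * ∫⁻ ω in D, ‖𝓕 G ω‖ₑ ^ 2 ≤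
      216 * volume U * ∑' v : V, (∫⁻ t in {t | t - (v : E3) ∈ U}, ‖G t‖ₑ) ^ 2 := by
    calc κ ^ 2 * ∫⁻ ω in D, ‖𝓕 G ω‖ₑ ^ 2
        = ∫⁻ ω in D, κ ^ 2 * ‖𝓕 G ω‖ₑ ^ 2 := by
          rw [lintegral_const_mul]
          exact (SchwartzMap.continuous _).enorm.measurable.pow_const 2
      _ ≤ ∫⁻ ω in D, ‖𝓕 H ω‖ₑ ^ 2 := by
          refine setLIntegral_mono' hD fun ω hω => ?_
          rw [hH, enorm_mul, ← mul_pow, mul_comm]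
          gcongr
          exact hlow ω hω
      _ ≤ ∫⁻ ω, ‖𝓕 H ω‖ₑ ^ 2 := setLIntegral_le_lintegral _ _
      _ = ∫⁻ x, ‖H x‖ₑ ^ 2 := lintegral_enorm_sq_fourier H
      _ ≤ ∫⁻ x, (∫⁻ t, (c • U).indicator (fun _ => 1) (x - t) * ‖G t‖ₑ) ^ 2 := by
          refine lintegral_mono fun x => ?_
          gcongr
          exact hHx x
      _ ≤ _ := hU.lintegral_near_sq_le hcov hd hc0.le hc1 G.continuous.enorm.measurable
  rw [ENNReal.tsum_mul_left]
  have hκ0 : κ ^ 2 ≠ 0 := pow_ne_zero 2 (mul_ne_zero (by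
    rw [Ne, ENNReal.ofReal_eq_zero, not_le]; positivity) hU0)
  have hκt : κ ^ 2 ≠ ⊤ := ENNReal.pow_ne_top (ENNReal.mul_ne_top ENNReal.ofReal_ne_top hUt)
  rw [← ENNReal.mul_le_mul_iff_right hκ0 hκt]
  refine hmain.trans (le_of_eq ?_)
  -- Since `c / 2 = 1 / (12 C)`, `κ² = |U|² / (4 (12 C)⁶)`; and `864 = 4 * 216`.
  have e : κ ^ 2 * ENNReal.ofReal (864 * (12 * C) ^ 6) = 216 * volume U ^ 2 := by
    rw [hκ, mul_pow, mul_right_comm, ← ENNReal.ofReal_pow (by positivity),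
      ← ENNReal.ofReal_mul (by positivity)]
    congr 1
    rw [show (216 : ℝ≥0∞) = ENNReal.ofReal 216 by norm_num]
    congr 1
    rw [hc]; field_simp; norm_num
  rw [← mul_assoc, ← mul_assoc, e]
  congr 1
  rw [mul_assoc, sq, mul_assoc, ENNReal.mul_inv_cancel hU0 hUt, mul_one]

end IsSymmConvexBody

/-! ### The boxes `U_{τ,R}` and their duals. -/

theorem mem_box_iff (s φ ρ : ℝ) (v x : E3) : x ∈ box s φ ρ v ↔ x - v ∈ box s φ ρ 0 := by
  simp [box]

/-- The core, normal and tangent directions are orthogonal, with squared lengths `2`, `2`, `1`. -/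
theorem inner_frame (φ : ℝ) (x ω : E3) : inner ℝ x ω =
    1 / 2 * (inner ℝ (coreDir φ) x * inner ℝ (coreDir φ) ω) +
    1 / 2 * (inner ℝ (normalDir φ) x * inner ℝ (normalDir φ) ω) +
    inner ℝ (tangentDir φ) x * inner ℝ (tangentDir φ) ω := by
  rw [inner_coreDir, inner_coreDir, inner_normalDir, inner_normalDir, inner_tangentDir,
    inner_tangentDir, radial, radial]
  simp only [PiLp.inner_apply, Fin.sum_univ_three, RCLike.inner_apply, conj_trivial]
  linear_combination (-(x 0 * ω 0) - x 1 * ω 1) * Real.sin_sq_add_cos_sq φ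

theorem isSymmConvexBody_box {s φ ρ : ℝ} (hs : 0 < s) (hρ : 0 < ρ) :
    IsSymmConvexBody (box s φ ρ 0) where
  convex := by
    have e : box s φ ρ 0 = (fun x => inner ℝ (coreDir φ) x) ⁻¹' Icc (-(ρ * s ^ 2)) (ρ * s ^ 2) ∩
        ((fun x => inner ℝ (normalDir φ) x) ⁻¹' Icc (-ρ) ρ ∩
        (fun x => inner ℝ (tangentDir φ) x) ⁻¹' Icc (-(ρ * s)) (ρ * s)) := by
      ext x; simp [box, abs_le]
    rw [e]
    exact ((convex_Icc _ _).is_linear_preimage (innerSL ℝ (coreDir φ)).isLinear).inter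
      (((convex_Icc _ _).is_linear_preimage (innerSL ℝ (normalDir φ)).isLinear).inter
      ((convex_Icc _ _).is_linear_preimage (innerSL ℝ (tangentDir φ)).isLinear))
  symm x hx := by simpa [box] using hx
  isClosed := by
    simp only [box, sub_zero, Set.ofPred_and]
    refine IsClosed.inter (isClosed_le (by fun_prop) (by fun_prop)) (IsClosed.inter
      (isClosed_le (by fun_prop) (by fun_prop)) (isClosed_le (by fun_prop) (by fun_prop)))
  bounded := by
    refine (Metric.isBounded_closedBall (x := (0 : E3))
      (r := (ρ * s ^ 2) ^ 2 + ρ ^ 2 + (ρ * s) ^ 2 + 1)).subset fun x hx => ?_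
    obtain ⟨h1, h2, h3⟩ := hx
    rw [sub_zero] at h1 h2 h3
    rw [mem_closedBall_zero_iff]
    have h := inner_frame φ x x
    rw [real_inner_self_eq_norm_sq] at h
    have q1 := sq_le_sq' (abs_le.1 h1).1 (abs_le.1 h1).2
    have q2 := sq_le_sq' (abs_le.1 h2).1 (abs_le.1 h2).2
    have q3 := sq_le_sq' (abs_le.1 h3).1 (abs_le.1 h3).2
    nlinarith [sq_nonneg (‖x‖ - 1), sq_nonneg (‖x‖), sq_nonneg (inner ℝ (coreDir φ) x),
      sq_nonneg (inner ℝ (normalDir φ) x)]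
  zero_mem := by
    have hopen : IsOpen {x : E3 | |inner ℝ (coreDir φ) x| < ρ * s ^ 2 ∧
        |inner ℝ (normalDir φ) x| < ρ ∧ |inner ℝ (tangentDir φ) x| < ρ * s} := by
      simp only [Set.ofPred_and]
      exact IsOpen.inter (isOpen_lt (by fun_prop) (by fun_prop)) (IsOpen.inter
        (isOpen_lt (by fun_prop) (by fun_prop)) (isOpen_lt (by fun_prop) (by fun_prop)))
    refine interior_maximal (fun x hx => ?_) hopen ?_
    · exact ⟨by simpa using hx.1.le, by simpa using hx.2.1.le, by simpa using hx.2.2.le⟩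
    · simp only [mem_ofPred_eq, inner_zero_right, abs_zero]
      exact ⟨by positivity, hρ, by positivity⟩

theorem measurableSet_dualBox (C σ s φ : ℝ) : MeasurableSet (dualBox C σ s φ) := by
  simp only [dualBox, Set.ofPred_and]
  exact (IsClosed.inter (isClosed_le (by fun_prop) (by fun_prop)) (IsClosed.inter
    (isClosed_le (by fun_prop) (by fun_prop))
    (isClosed_le (by fun_prop) (by fun_prop)))).measurableSet

/-- Each coordinate product is at most `R · C σ² = C`, and the frame weights `1/2`, `1/2`, `1` add
up to `2`. -/
theorem abs_inner_le_of_mem_dualBox {C R s φ : ℝ} (hR : 0 < R) {ω x : E3}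
    (hω : ω ∈ dualBox C (√R)⁻¹ s φ) (hx : x ∈ box s φ R 0) : |inner ℝ x ω| ≤ 2 * C := by
  obtain ⟨h1, h2, h3⟩ := hx
  obtain ⟨k1, k2, k3⟩ := hω
  rw [sub_zero] at h1 h2 h3
  have hσ : ((√R)⁻¹) ^ 2 = R⁻¹ := by rw [inv_pow, Real.sq_sqrt hR.le]
  rw [hσ] at k1 k2 k3
  have hRR : R * (C * R⁻¹) = C := by field_simp
  have m1 : |inner ℝ (coreDir φ) x * inner ℝ (coreDir φ) ω| ≤ C := by
    rw [abs_mul]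
    calc _ ≤ (R * s ^ 2) * |inner ℝ (coreDir φ) ω| := by gcongr
      _ = R * (|inner ℝ (coreDir φ) ω| * s ^ 2) := by ring
      _ ≤ R * (C * R⁻¹) := by gcongr
      _ = C := hRR
  have m2 : |inner ℝ (normalDir φ) x * inner ℝ (normalDir φ) ω| ≤ C := by
    rw [abs_mul]
    calc _ ≤ R * (C * R⁻¹) := by gcongr
      _ = C := hRR
  have m3 : |inner ℝ (tangentDir φ) x * inner ℝ (tangentDir φ) ω| ≤ C := by
    rw [abs_mul]
    calc _ ≤ (R * s) * |inner ℝ (tangentDir φ) ω| := by gcongr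
      _ = R * (|inner ℝ (tangentDir φ) ω| * s) := by ring
      _ ≤ R * (C * R⁻¹) := by gcongr
      _ = C := hRR
  rw [inner_frame φ x ω]
  rw [abs_le] at m1 m2 m3 ⊢
  constructor <;> linarith [m1.1, m1.2, m2.1, m2.2, m3.1, m3.2]

/-- The local `L²` estimate for the part of a square function that comes from one sector. -/
theorem lintegral_dualBox_le {R s φ : ℝ} (hR : 0 < R) (hs : 0 < s) {V : Set E3}
    (hV : IsBoxTiling s φ R V) (G : 𝓢(E3, ℂ)) :
    ∫⁻ ω in dualBox 40000 (√R)⁻¹ s φ, ‖𝓕 G ω‖ₑ ^ 2 ≤ ENNReal.ofReal (864 * (12 * 80000) ^ 6) *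
      ∑' v : V, (volume (box s φ R v))⁻¹ * (∫⁻ t in box s φ R v, ‖G t‖ₑ) ^ 2 := by
  have hbox : ∀ v, box s φ R v = {x | x - v ∈ box s φ R 0} := fun v =>
    Set.ext fun x => mem_box_iff s φ R v x
  have h := (isSymmConvexBody_box (φ := φ) hs hR).lintegral_fourier_sq_le (V := V)
    (fun x => by
      have hx : x ∈ ⋃ v ∈ V, box s φ R v := by rw [hV.1]; trivial
      simp only [mem_iUnion, exists_prop] at hx
      obtain ⟨v, hv, hxv⟩ := hx
      exact ⟨v, hv, (mem_box_iff s φ R v x).1 hxv⟩)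
    (by simpa only [← hbox] using hV.2) (C := 80000) (by norm_num)
    (measurableSet_dualBox 40000 (√R)⁻¹ s φ)
    (fun ω hω x hx => (abs_inner_le_of_mem_dualBox hR hω hx).trans (by norm_num)) G
  refine h.trans (le_of_eq ?_)
  congr 2; ext v
  rw [hbox v, volume_translate]

/-! ### The Kakeya-type estimate. -/

theorem sq_sum_le_card_mul {ι : Type*} (t : Finset ι) (a : ι → ℝ≥0∞) :
    (∑ i ∈ t, a i) ^ 2 ≤ t.card * ∑ i ∈ t, a i ^ 2 := by
  have h := tsum_mul_sq_le (fun _ : t => (1 : ℝ≥0∞)) (fun i => a i)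
  simp only [one_mul, tsum_fintype, Finset.sum_coe_sort t (fun i => a i),
    Finset.sum_coe_sort t (fun i => a i ^ 2)] at h
  simpa using h

theorem countable_dyadicScales (R : ℝ) : (dyadicScales R).Countable := by
  refine (Set.countable_range fun k : ℕ => (2 : ℝ)⁻¹ ^ k).mono ?_
  rintro _ ⟨⟨k, rfl⟩, _⟩
  exact ⟨k, rfl⟩

theorem pos_of_mem_dyadicScales {R s : ℝ} (hs : s ∈ dyadicScales R) : 0 < s := by
  obtain ⟨⟨k, rfl⟩, _⟩ := hs
  positivity

theorem enorm_sum_absSq {ι : Type*} (t : Finset ι) (g : ι → 𝓢(E3, ℂ)) (x : E3) :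
    ‖(∑ j ∈ t, absSq (g j)) x‖ₑ = ∑ j ∈ t, ‖g j x‖ₑ ^ 2 := by
  rw [sum_apply]
  simp only [absSq_apply]
  rw [← Complex.ofReal_sum, ← ofReal_norm, Complex.norm_real,
    Real.norm_of_nonneg (Finset.sum_nonneg fun j _ => by positivity),
    ENNReal.ofReal_sum_of_nonneg fun j _ => by positivity]
  refine Finset.sum_congr rfl fun j _ => ?_
  rw [ENNReal.ofReal_pow (norm_nonneg _), ofReal_norm]

/-- The Kakeya-type estimate for Schwartz functions. -/
theorem lintegral_sum_sq_le {R : ℝ} (hR : 100 ≤ R) (A : Nesting R)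
    (T : (s : ℝ) → Fin (numSectors s) → Set E3)
    (hT : ∀ s ∈ dyadicScales R, ∀ i, IsBoxTiling s (sectorAngle s i) R (T s i))
    (g : Fine R → 𝓢(E3, ℂ))
    (hg : ∀ j ω, 𝓕 (absSq (g j)) ω ≠ 0 → ω ∈ plank (√R)⁻¹ (sectorAngle (√R)⁻¹ j)) :
    ∫⁻ x, (∑ j, ‖g j x‖ₑ ^ 2) ^ 2 ≤ 154 * ENNReal.ofReal (864 * (12 * 80000) ^ 6) *
      ∑' s : dyadicScales R, ∑ i, ∑' v : T s i, (volume (box s (sectorAngle s i) R v))⁻¹ *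
        (∫⁻ t in box s (sectorAngle s i) R v, ∑ j ∈ A.children s i, ‖g j t‖ₑ ^ 2) ^ 2 := by
  classical
  have : Countable (dyadicScales R) := (countable_dyadicScales R).to_subtype
  let P : (s : ℝ) → Fin (numSectors s) → 𝓢(E3, ℂ) := fun s i => ∑ j ∈ A.children s i, absSq (g j)
  let Q : (s : ℝ) → Fin (numSectors s) → Set E3 := fun s i =>
    dualBox 40000 (√R)⁻¹ s (sectorAngle s i)
  have hFsum : ∀ (t : Finset (Fine R)) (ω : E3), 𝓕 (∑ j ∈ t, absSq (g j)) ω =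
      ∑ j ∈ t, 𝓕 (absSq (g j)) ω := by
    intro t ω
    have := map_sum (FourierTransform.fourierCLM ℂ 𝓢(E3, ℂ)) (fun j => absSq (g j)) t
    simp only [FourierTransform.fourierCLM_apply] at this
    rw [this, sum_apply]
  -- The good scale depends on `ω`. Grouping the `θ` by parents at that scale leaves at most `154`
  -- nonzero terms, each with `ω` in its dual box; enlarging to the sum over all scales removes the
  -- dependence on `ω`.
  have hpt : ∀ ω, ‖𝓕 (∑ j, absSq (g j)) ω‖ₑ ^ 2 ≤
      154 * ∑' s : dyadicScales R, ∑ i, (Q s i).indicator (fun ω => ‖𝓕 (P s i) ω‖ₑ ^ 2) ω := by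
    intro ω
    obtain ⟨s, hs, t, ht, hst⟩ := exists_scale hR A ω
    have hzero : ∀ i, ω ∉ Q s i ∨ i ∉ t → 𝓕 (P s i) ω = 0 := by
      intro i hi
      rw [hFsum]
      refine Finset.sum_eq_zero fun j hj => ?_
      by_contra h
      obtain ⟨h1, h2⟩ := hst i j hj (hg j ω h)
      exact hi.elim (fun h => h h2) (fun h => h h1)
    have hsum : 𝓕 (∑ j, absSq (g j)) ω = ∑ i ∈ t, 𝓕 (P s i) ω := by
      rw [hFsum, ← Finset.sum_fiberwise _ (A.parent s)]
      rw [← Finset.sum_subset (Finset.subset_univ t)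
        (fun i _ hi => by rw [← hFsum]; exact hzero i (Or.inr hi))]
      exact Finset.sum_congr rfl fun i _ => (hFsum _ _).symm
    calc ‖𝓕 (∑ j, absSq (g j)) ω‖ₑ ^ 2 ≤ (∑ i ∈ t, ‖𝓕 (P s i) ω‖ₑ) ^ 2 := by
          rw [hsum]; gcongr; exact enorm_sum_le _ _
      _ ≤ t.card * ∑ i ∈ t, ‖𝓕 (P s i) ω‖ₑ ^ 2 := sq_sum_le_card_mul _ _
      _ ≤ 154 * ∑ i, (Q s i).indicator (fun ω => ‖𝓕 (P s i) ω‖ₑ ^ 2) ω := by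
          gcongr
          · exact_mod_cast ht
          · refine (Finset.sum_le_univ_sum_of_nonneg fun _ => zero_le).trans
              (Finset.sum_le_sum fun i _ => ?_)
            by_cases h : ω ∈ Q s i
            · rw [Set.indicator_of_mem h]
            · rw [hzero i (Or.inl h)]; simp
      _ ≤ _ := by
          gcongr
          exact ENNReal.le_tsum (f := fun s : dyadicScales R =>
            ∑ i, (Q s i).indicator (fun ω => ‖𝓕 (P s i) ω‖ₑ ^ 2) ω) ⟨s, hs⟩
  have hmeas : ∀ s i, Measurable ((Q s i).indicator fun ω => ‖𝓕 (P s i) ω‖ₑ ^ 2) := fun s i =>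
    ((SchwartzMap.continuous _).enorm.measurable.pow_const 2).indicator
      (measurableSet_dualBox _ _ _ _)
  have hmeas' : ∀ s : dyadicScales R, Measurable fun ω =>
      ∑ i, (Q s i).indicator (fun ω => ‖𝓕 (P s i) ω‖ₑ ^ 2) ω := fun s =>
    Finset.measurable_fun_sum _ fun i _ => hmeas s i
  calc ∫⁻ x, (∑ j, ‖g j x‖ₑ ^ 2) ^ 2 = ∫⁻ x, ‖(∑ j, absSq (g j)) x‖ₑ ^ 2 := by
        simp_rw [enorm_sum_absSq]
    _ = ∫⁻ ω, ‖𝓕 (∑ j, absSq (g j)) ω‖ₑ ^ 2 := (lintegral_enorm_sq_fourier _).symm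
    _ ≤ ∫⁻ ω, 154 * ∑' s : dyadicScales R,
          ∑ i, (Q s i).indicator (fun ω => ‖𝓕 (P s i) ω‖ₑ ^ 2) ω := lintegral_mono hpt
    _ = 154 * ∑' s : dyadicScales R, ∑ i, ∫⁻ ω in Q s i, ‖𝓕 (P s i) ω‖ₑ ^ 2 := by
        rw [lintegral_const_mul _ (Measurable.tsum hmeas'),
          lintegral_tsum fun s => (hmeas' s).aemeasurable]
        congr 2; ext s
        rw [lintegral_finsetSum _ fun i _ => hmeas s i]
        exact Finset.sum_congr rfl fun i _ => lintegral_indicator (measurableSet_dualBox _ _ _ _) _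
    _ ≤ 154 * ∑' s : dyadicScales R, ∑ i, ENNReal.ofReal (864 * (12 * 80000) ^ 6) *
          ∑' v : T s i, (volume (box s (sectorAngle s i) R v))⁻¹ *
            (∫⁻ t in box s (sectorAngle s i) R v, ∑ j ∈ A.children s i, ‖g j t‖ₑ ^ 2) ^ 2 := by
        gcongr with s i
        have := lintegral_dualBox_le (by linarith) (pos_of_mem_dyadicScales s.2) (hT s s.2 i) (P s i)
        simpa only [P, enorm_sum_absSq] using this
    _ = _ := by
        simp_rw [← Finset.mul_sum, ENNReal.tsum_mul_left]
        rw [mul_assoc]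

theorem eLpNorm_sqrt_pow_four {h : E3 → ℝ} (h0 : ∀ x, 0 ≤ h x) (μ : Measure E3) :
    eLpNorm (fun x => √(h x)) 2 μ ^ 4 = (∫⁻ x, ENNReal.ofReal (h x) ∂μ) ^ 2 := by
  have e := eLpNorm_nnreal_pow_eq_lintegral (f := fun x => √(h x)) (μ := μ) (p := 2) (by norm_num)
  have e2 : eLpNorm (fun x => √(h x)) 2 μ ^ 2 = ∫⁻ x, ENNReal.ofReal (h x) ∂μ := by
    rw [← ENNReal.rpow_natCast]
    refine Eq.trans ?_ (e.trans ?_)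
    · norm_num
    · congr 1; ext x
      norm_num
      rw [← ofReal_norm, ← ENNReal.ofReal_pow (norm_nonneg _), Real.norm_of_nonneg (Real.sqrt_nonneg _),
        Real.sq_sqrt (h0 x)]
  rw [show 4 = 2 * 2 by norm_num, pow_mul, e2]

theorem ofReal_sum_norm_sq {ι : Type*} (t : Finset ι) (z : ι → ℂ) :
    ENNReal.ofReal (∑ j ∈ t, ‖z j‖ ^ 2) = ∑ j ∈ t, ‖z j‖ₑ ^ 2 := by
  rw [ENNReal.ofReal_sum_of_nonneg fun j _ => by positivity]
  refine Finset.sum_congr rfl fun j _ => ?_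
  rw [ENNReal.ofReal_pow (norm_nonneg _), ofReal_norm]

theorem eLpNorm_sqrt_sum_pow_four {ι : Type*} (t : Finset ι) (z : ι → E3 → ℂ) (μ : Measure E3) :
    eLpNorm (fun x => √(∑ j ∈ t, ‖z j x‖ ^ 2)) 2 μ ^ 4 = (∫⁻ x, ∑ j ∈ t, ‖z j x‖ₑ ^ 2 ∂μ) ^ 2 := by
  rw [eLpNorm_sqrt_pow_four fun x => Finset.sum_nonneg fun j _ => by positivity]
  simp_rw [ofReal_sum_norm_sq]

theorem multiscaleSum_eq {R : ℝ} {f : E3 → ℂ} (D : Decomposition R f) (A : Nesting R)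
    (T : (s : ℝ) → Fin (numSectors s) → Set E3) : multiscaleSum D A T =
      ∑' s : dyadicScales R, ∑ i, ∑' v : T s i, (volume (box s (sectorAngle s i) R v))⁻¹ *
        (∫⁻ t in box s (sectorAngle s i) R v, ∑ j ∈ A.children s i, ‖D.piece j t‖ₑ ^ 2) ^ 2 := by
  simp only [multiscaleSum, ← eLpNorm_sqrt_sum_pow_four]
  rfl

theorem ballSum_eq {R : ℝ} {f : E3 → ℂ} (D : Decomposition R f) (A : Nesting R) (r : ℝ)
    (B : Set E3) : ballSum D A r B = ∑' v : B, (volume (Metric.closedBall (v : E3) r))⁻¹ *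
      (∫⁻ x in Metric.closedBall (v : E3) r, ∑ i, ‖coarsePiece D A (√r)⁻¹ i x‖ₑ ^ 2) ^ 2 := by
  simp only [ballSum, ← eLpNorm_sqrt_sum_pow_four]
  rfl

theorem norm_coreDir_le (φ : ℝ) : ‖coreDir φ‖ ≤ 3 / 2 := by
  refine abs_le_of_sq_le_sq' ?_ (by norm_num) |>.2
  have e : ‖coreDir φ‖ ^ 2 = Real.cos φ ^ 2 + Real.sin φ ^ 2 + 1 := by
    rw [EuclideanSpace.real_norm_sq_eq, Fin.sum_univ_three]
    simp [coreDir]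
  rw [e, Real.cos_sq_add_sin_sq]
  norm_num

theorem norm_normalDir_le (φ : ℝ) : ‖normalDir φ‖ ≤ 3 / 2 := by
  refine abs_le_of_sq_le_sq' ?_ (by norm_num) |>.2
  have e : ‖normalDir φ‖ ^ 2 = Real.cos φ ^ 2 + Real.sin φ ^ 2 + 1 := by
    rw [EuclideanSpace.real_norm_sq_eq, Fin.sum_univ_three]
    simp [normalDir]
  rw [e, Real.cos_sq_add_sin_sq]
  norm_num

/-- `ω` is the difference of `ξ` and `ξ - ω`. The bounds `5/2`, `2 σ²`, `2 σ` double, and the two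
`σ²`-errors fit in the remaining room below `8`, `8 σ²`, `8 σ`. -/
theorem sub_mem_plank {σ φ : ℝ} (h0 : 0 < σ) (h1 : σ ≤ 1 / 10) {ξ ω k k' : E3}
    (hk : k ∈ fatSector σ φ) (hk' : k' ∈ fatSector σ φ) (hd : dist ξ k ≤ σ ^ 2)
    (hd' : dist (ξ - ω) k' ≤ σ ^ 2) : ω ∈ plank σ φ := by
  have key : ∀ (u : E3) (c m : ℝ), ‖u‖ ≤ c → |inner ℝ u k| ≤ m → |inner ℝ u k'| ≤ m →
      |inner ℝ u ω| ≤ 2 * m + 2 * (c * σ ^ 2) := by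
    intro u c m hu hm hm'
    have hc : 0 ≤ c := (norm_nonneg u).trans hu
    rw [dist_eq_norm] at hd hd'
    have e : inner ℝ u ω = inner ℝ u k - inner ℝ u k' + inner ℝ u (ξ - k) -
        inner ℝ u (ξ - ω - k') := by simp only [inner_sub_right]; ring
    have a1 : |inner ℝ u (ξ - k)| ≤ c * σ ^ 2 :=
      (abs_real_inner_le_norm _ _).trans (mul_le_mul hu hd (norm_nonneg _) hc)
    have a2 : |inner ℝ u (ξ - ω - k')| ≤ c * σ ^ 2 :=
      (abs_real_inner_le_norm _ _).trans (mul_le_mul hu hd' (norm_nonneg _) hc)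
    rw [e]
    rw [abs_le] at *
    constructor <;> linarith [hm.1, hm.2, hm'.1, hm'.2, a1.1, a1.2, a2.1, a2.2]
  have hσ2 : σ ^ 2 ≤ 1 / 100 := by nlinarith
  have ht : ‖tangentDir φ‖ ≤ 1 := by
    have := abs_tangent_le φ (tangentDir φ)
    rw [real_inner_self_eq_norm_sq, abs_of_nonneg (sq_nonneg _)] at this
    by_contra! h
    nlinarith
  refine ⟨?_, ?_, ?_⟩
  · have := key _ _ _ (norm_coreDir_le φ) hk.2.1 hk'.2.1
    linarith
  · have := key _ _ _ (norm_normalDir_le φ) hk.2.2.1 hk'.2.2.1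
    nlinarith
  · have := key _ _ _ ht hk.2.2.2 hk'.2.2.2
    nlinarith

theorem Decomposition.hasTemperateGrowth {R : ℝ} {f : E3 → ℂ} (D : Decomposition R f) (j : Fine R) :
    (D.piece j).HasTemperateGrowth := (D.supported j).1

theorem Decomposition.measurable_piece {R : ℝ} {f : E3 → ℂ} (D : Decomposition R f) (j : Fine R) :
    Measurable (D.piece j) := (D.hasTemperateGrowth j).1.continuous.measurable

/-- The Kakeya-type estimate: the fourth power of the `L⁴` norm of the full square function is
controlled by the multiscale sum. -/
theorem lintegral_square_sq_le_multiscaleSum {R : ℝ} (hR : 100 ≤ R) {f : E3 → ℂ}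
    (D : Decomposition R f) (A : Nesting R) (T : (s : ℝ) → Fin (numSectors s) → Set E3)
    (hT : ∀ s ∈ dyadicScales R, ∀ i, IsBoxTiling s (sectorAngle s i) R (T s i)) :
    ∫⁻ x, (∑ j, ‖D.piece j x‖ₑ ^ 2) ^ 2 ≤
      154 * ENNReal.ofReal (864 * (12 * 80000) ^ 6) * multiscaleSum D A T := by
  obtain ⟨hσ0, hσ1, hσ2⟩ := inv_sqrt_bounds hR
  obtain ⟨η, hη1, hη0, -, hη⟩ := exists_bandlimited_cutoff
  -- Cutting off at scale `(n + 1) R` blurs frequencies by at most `R⁻¹ = σ²`, so the planks are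
  -- preserved.
  have hρ : ∀ n : ℕ, 0 < ((n : ℝ) + 1) * R := fun n => by positivity
  choose b hb hbη using fun n : ℕ => hη 0 (((n : ℝ) + 1) * R) (hρ n)
  let g : ℕ → Fine R → 𝓢(E3, ℂ) := fun n j => SchwartzMap.smulLeftCLM ℂ (D.piece j) (𝓕 (b n))
  have hgx : ∀ n j x, g n j x = D.piece j x * η ((((n : ℝ) + 1) * R)⁻¹ • x) := by
    intro n j x
    simp only [g, SchwartzMap.smulLeftCLM_apply_apply (D.hasTemperateGrowth j), hbη, sub_zero,
      smul_eq_mul]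
  have hbnd : ∀ n, ∫⁻ x, (∑ j, ‖g n j x‖ₑ ^ 2) ^ 2 ≤
      154 * ENNReal.ofReal (864 * (12 * 80000) ^ 6) * multiscaleSum D A T := by
    intro n
    refine (lintegral_sum_sq_le hR A T hT (g n) fun j ω h => ?_).trans ?_
    · obtain ⟨ξ, h1, h2⟩ := exists_of_fourier_absSq_ne_zero _ h
      obtain ⟨k, hk, hkd⟩ := (D.supported j).exists_dist_le (hb n) h1
      obtain ⟨k', hk', hkd'⟩ := (D.supported j).exists_dist_le (hb n) h2
      have hle : (((n : ℝ) + 1) * R)⁻¹ ≤ ((√R)⁻¹) ^ 2 := by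
        rw [hσ2]
        exact inv_anti₀ (by linarith) (le_mul_of_one_le_left (by linarith)
          (by linarith [n.cast_nonneg (α := ℝ)]))
      exact sub_mem_plank hσ0 hσ1 hk hk' (hkd.trans hle) (hkd'.trans hle)
    · rw [multiscaleSum_eq]
      gcongr with s i v x j
      rw [hgx, enorm_mul]
      refine mul_le_of_le_one_right' ?_
      rw [← ofReal_norm]
      exact ENNReal.ofReal_le_one.2 (hη1 _)
  have hlim : ∀ x, Filter.Tendsto (fun n => (∑ j, ‖g n j x‖ₑ ^ 2) ^ 2) Filter.atTop
      (nhds ((∑ j, ‖D.piece j x‖ₑ ^ 2) ^ 2)) := by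
    intro x
    have h1 : Filter.Tendsto (fun n : ℕ => (((n : ℝ) + 1) * R)⁻¹ • x) Filter.atTop
        (nhds ((0 : ℝ) • x)) := by
      refine Filter.Tendsto.smul_const ?_ x
      refine tendsto_inv_atTop_zero.comp ?_
      exact (Filter.tendsto_atTop_add_const_right _ _ tendsto_natCast_atTop_atTop).atTop_mul_const
        (by linarith)
    rw [zero_smul] at h1
    have h2 : ∀ j, Filter.Tendsto (fun n => g n j x) Filter.atTop (nhds (D.piece j x)) := by
      intro j
      simp_rw [hgx]
      have := ((η.continuous.tendsto 0).comp h1).const_mul (D.piece j x)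
      rwa [hη0, mul_one] at this
    have h3 : Continuous fun z : Fine R → ℂ => (∑ j, ‖z j‖ₑ ^ 2) ^ 2 :=
      (ENNReal.continuous_pow 2).comp (continuous_finsetSum _ fun j _ =>
        (ENNReal.continuous_pow 2).comp (continuous_apply j).enorm)
    exact (h3.tendsto (fun j => D.piece j x)).comp (tendsto_pi_nhds.2 h2)
  -- Since `η 0 = 1`, the cutoffs converge pointwise to `1`; Fatou removes them from a bound uniform
  -- in `n`.
  calc ∫⁻ x, (∑ j, ‖D.piece j x‖ₑ ^ 2) ^ 2
      = ∫⁻ x, Filter.liminf (fun n => (∑ j, ‖g n j x‖ₑ ^ 2) ^ 2) Filter.atTop := by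
        congr 1; ext x; exact (hlim x).liminf_eq.symm
    _ ≤ Filter.liminf (fun n => ∫⁻ x, (∑ j, ‖g n j x‖ₑ ^ 2) ^ 2) Filter.atTop :=
        lintegral_liminf_le fun n => (Finset.measurable_fun_sum _ fun j _ =>
          ((g n j).continuous.enorm.measurable.pow_const 2)).pow_const 2
    _ ≤ _ := by
        refine (Filter.liminf_le_liminf (Filter.Eventually.of_forall hbnd)).trans ?_
        simp

/-! ### From balls to the `L⁴` norm: weights and local orthogonality. -/

theorem lintegral_mul_sq_le {w G : E3 → ℝ≥0∞} (hw : Measurable w) (hG : Measurable G) :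
    (∫⁻ x, w x * G x) ^ 2 ≤ (∫⁻ x, w x) * ∫⁻ x, w x * G x ^ 2 := by
  have h := ENNReal.lintegral_mul_le_Lp_mul_Lq (volume.withDensity w)
    (Real.HolderConjugate.two_two) (f := fun _ => 1) (g := G) aemeasurable_const hG.aemeasurable
  simp only [Pi.mul_apply, one_mul, ENNReal.one_rpow, lintegral_one] at h
  rw [lintegral_withDensity_eq_lintegral_mul _ hw hG,
    lintegral_withDensity_eq_lintegral_mul _ hw (hG.pow_const _),
    withDensity_apply _ MeasurableSet.univ, Measure.restrict_univ,
    ← ENNReal.mul_rpow_of_nonneg _ _ (by norm_num)] at h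
  simp only [Pi.mul_apply] at h
  have h2 := ENNReal.rpow_le_rpow h (by norm_num : (0 : ℝ) ≤ 2)
  rw [← ENNReal.rpow_mul] at h2
  norm_num at h2
  exact h2

/-- The decaying weight at scale `ρ`. -/
def weight (ρ : ℝ) (x : E3) : ℝ≥0∞ := ENNReal.ofReal ((1 + ‖ρ⁻¹ • x‖) ^ (-4 : ℝ))

theorem measurable_weight (ρ : ℝ) : Measurable (weight ρ) := by
  unfold weight; fun_prop

theorem lintegral_weight {ρ : ℝ} (hρ : 0 < ρ) :
    ∫⁻ x, weight ρ x = ENNReal.ofReal (ρ ^ 3) * ∫⁻ x, weight 1 x := by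
  have hm := measurable_weight 1
  have h := Measure.map_addHaar_smul (volume : Measure E3) (inv_ne_zero hρ.ne')
  have e : ∀ x, weight ρ x = weight 1 (ρ⁻¹ • x) := fun x => by simp [weight]
  simp_rw [e]
  rw [← lintegral_map (f := weight 1) (g := fun x : E3 => ρ⁻¹ • x) hm (by fun_prop)]
  rw [h, lintegral_smul_measure, finrank_euclideanSpace_fin, abs_of_pos (by positivity)]
  simp

theorem lintegral_weight_ne_top : ∫⁻ x, weight 1 x ≠ ⊤ := by
  have := finite_integral_one_add_norm (μ := (volume : Measure E3)) (r := 4)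
    (by rw [finrank_euclideanSpace_fin]; norm_num)
  simpa [weight] using this.ne

/-- Moving the centre by at most `ρ` at most doubles `1 + ‖·‖`, and `2 ^ 4 = 16`. -/
theorem weight_le_of_dist_le {ρ : ℝ} (hρ : 0 < ρ) {x v y : E3} (h : dist y v ≤ ρ) :
    weight ρ (x - v) ≤ 16 * weight ρ (x - y) := by
  unfold weight
  rw [show (16 : ℝ≥0∞) = ENNReal.ofReal 16 by norm_num, ← ENNReal.ofReal_mul (by norm_num)]
  refine ENNReal.ofReal_le_ofReal ?_
  have h1 : 1 + ‖ρ⁻¹ • (x - y)‖ ≤ 2 * (1 + ‖ρ⁻¹ • (x - v)‖) := by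
    have e : ρ⁻¹ • (x - y) = ρ⁻¹ • (x - v) - ρ⁻¹ • (y - v) := by rw [← smul_sub]; congr 1; abel
    have e2 : ‖ρ⁻¹ • (y - v)‖ ≤ 1 := by
      rw [norm_smul, norm_inv, Real.norm_of_nonneg hρ.le, ← dist_eq_norm, inv_mul_le_iff₀ hρ]
      linarith
    have := norm_sub_le (ρ⁻¹ • (x - v)) (ρ⁻¹ • (y - v))
    rw [e]
    linarith [norm_nonneg (ρ⁻¹ • (x - v))]
  have hp : ∀ a : ℝ, 0 < a → a ^ (-4 : ℝ) = (a ^ 4)⁻¹ := fun a ha => by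
    rw [Real.rpow_neg ha.le]; norm_cast
  have hx : 0 < 1 + ‖ρ⁻¹ • (x - y)‖ := by positivity
  have hv : 0 < 1 + ‖ρ⁻¹ • (x - v)‖ := by positivity
  rw [hp _ hx, hp _ hv, ← div_eq_mul_inv, inv_eq_one_div, div_le_div_iff₀ (by positivity)
    (by positivity), one_mul]
  calc (1 + ‖ρ⁻¹ • (x - y)‖) ^ 4 ≤ (2 * (1 + ‖ρ⁻¹ • (x - v)‖)) ^ 4 :=
        pow_le_pow_left₀ hx.le h1 4
    _ = _ := by ring

/-- The weights adapted to the balls of a cover have bounded sum. -/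
theorem sum_weight_le {M : ℕ} {r : ℝ} (hr : 0 < r) {B : Set E3} (hB : IsBallCover M r B)
    (t : Finset B) (x : E3) :
    ∑ v ∈ t, weight r (x - v) ≤
      16 * M * (∫⁻ y, weight 1 y) * (volume (Metric.ball (0 : E3) 1))⁻¹ := by
  classical
  set β := volume (Metric.ball (0 : E3) 1) with hβ
  have hβ0 : β ≠ 0 := (Metric.measure_ball_pos volume _ one_pos).ne'
  have hβt : β ≠ ⊤ := measure_ball_lt_top.ne
  have hvol : ∀ v : E3, volume (Metric.closedBall v r) = ENNReal.ofReal (r ^ 3) * β := fun v => by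
    rw [Measure.addHaar_closedBall _ _ hr.le, finrank_euclideanSpace_fin]
  have hr0 : ENNReal.ofReal (r ^ 3) ≠ 0 := by
    rw [Ne, ENNReal.ofReal_eq_zero, not_le]; positivity
  have hcount : ∀ y, ∑ v ∈ t, (Metric.closedBall (v : E3) r).indicator (fun _ => (1 : ℝ≥0∞)) y ≤
      M := by
    intro y
    have h := hB.2 y
    have e : ∑ v ∈ t, (Metric.closedBall (v : E3) r).indicator (fun _ => (1 : ℝ≥0∞)) y =
        ((t.filter fun v : B => y ∈ Metric.closedBall (v : E3) r).card : ℝ≥0∞) := by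
      rw [Finset.card_filter]
      push_cast
      exact Finset.sum_congr rfl fun v _ => by simp only [Set.indicator_apply]
    rw [e]
    have h2 : (((t.filter fun v : B => y ∈ Metric.closedBall (v : E3) r).map
        (Function.Embedding.subtype _) : Finset E3) : Set E3).encard ≤ M := by
      refine le_trans (Set.encard_le_encard ?_) h
      intro z hz
      simp only [Finset.coe_map, Set.mem_image, Finset.mem_coe, Finset.mem_filter] at hz
      obtain ⟨v, ⟨_, hv⟩, rfl⟩ := hz
      exact ⟨v.2, hv⟩
    rw [Set.encard_coe_eq_coe_finsetCard, Finset.card_map] at h2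
    exact_mod_cast h2
  -- Each weight is compared with its average over its own ball; bounded overlap then reduces the
  -- sum to `M` times one integral.
  have key : (∑ v ∈ t, weight r (x - v)) * (ENNReal.ofReal (r ^ 3) * β) ≤
      16 * M * (ENNReal.ofReal (r ^ 3) * ∫⁻ y, weight 1 y) := by
    calc (∑ v ∈ t, weight r (x - v)) * (ENNReal.ofReal (r ^ 3) * β)
        = ∑ v ∈ t, ∫⁻ y in Metric.closedBall (v : E3) r, weight r (x - v) := by
          rw [Finset.sum_mul]
          refine Finset.sum_congr rfl fun v _ => ?_
          rw [setLIntegral_const, hvol]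
      _ ≤ ∑ v ∈ t, ∫⁻ y, (Metric.closedBall (v : E3) r).indicator (fun _ => (1 : ℝ≥0∞)) y *
            (16 * weight r (x - y)) := by
          refine Finset.sum_le_sum fun v _ => ?_
          rw [← lintegral_indicator Metric.isClosed_closedBall.measurableSet]
          refine lintegral_mono fun y => ?_
          by_cases hy : y ∈ Metric.closedBall (v : E3) r
          · rw [Set.indicator_of_mem hy, Set.indicator_of_mem hy, one_mul]
            exact weight_le_of_dist_le hr hy
          · simp [Set.indicator_of_notMem hy]
      _ = ∫⁻ y, (∑ v ∈ t, (Metric.closedBall (v : E3) r).indicator (fun _ => (1 : ℝ≥0∞)) y) *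
            (16 * weight r (x - y)) := by
          simp_rw [Finset.sum_mul]
          rw [lintegral_finsetSum]
          intro v _
          exact (measurable_const.indicator Metric.isClosed_closedBall.measurableSet).mul
            (((measurable_weight r).comp (measurable_const.sub measurable_id)).const_mul 16)
      _ ≤ ∫⁻ y, (M * 16) * weight r (x - y) := by
          refine lintegral_mono fun y => ?_
          rw [mul_assoc]
          gcongr
          exact hcount y
      _ = 16 * M * (ENNReal.ofReal (r ^ 3) * ∫⁻ y, weight 1 y) := by
          have hm : Measurable fun y => weight r (x - y) :=
            (measurable_weight r).comp (measurable_const.sub measurable_id)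
          rw [lintegral_const_mul _ hm, lintegral_sub_left_eq_self (weight r) x, lintegral_weight hr, mul_comm (M : ℝ≥0∞)]
  rw [← ENNReal.mul_le_mul_iff_left (mul_ne_zero hr0 hβ0)
    (ENNReal.mul_ne_top ENNReal.ofReal_ne_top hβt)]
  refine key.trans (le_of_eq ?_)
  rw [show 16 * (M : ℝ≥0∞) * (∫⁻ y, weight 1 y) * β⁻¹ * (ENNReal.ofReal (r ^ 3) * β) =
    16 * M * (ENNReal.ofReal (r ^ 3) * ∫⁻ y, weight 1 y) * (β⁻¹ * β) by ring,
    ENNReal.inv_mul_cancel hβ0 hβt, mul_one]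

/-- Local orthogonality on a ball. -/
theorem lintegral_ball_le {R : ℝ} (hR : 100 ≤ R) {f : E3 → ℂ} (D : Decomposition R f)
    (A : Nesting R) {s r : ℝ} (hr : √R ≤ r) {b : 𝓢(E3, ℂ)}
    (hb : tsupport b ⊆ Metric.closedBall 0 r⁻¹) {B : Set E3} (hB : MeasurableSet B)
    (hbB : ∀ x ∈ B, 1 / 2 ≤ ‖𝓕 b x‖) :
    ∫⁻ x in B, ∑ i, ‖coarsePiece D A s i x‖ₑ ^ 2 ≤
      2120 * ∫⁻ x, ‖𝓕 b x‖ₑ ^ 2 * ∑ j, ‖D.piece j x‖ₑ ^ 2 := by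
  classical
  obtain ⟨hσ0, hσ1, -⟩ := inv_sqrt_bounds hR
  have hrσ : r⁻¹ ≤ (√R)⁻¹ := inv_anti₀ (inv_pos.1 hσ0) hr
  let h : Fine R → 𝓢(E3, ℂ) := fun j => SchwartzMap.smulLeftCLM ℂ (D.piece j) (𝓕 b)
  have hhx : ∀ j x, h j x = D.piece j x * 𝓕 b x := fun j x => by
    simp only [h, SchwartzMap.smulLeftCLM_apply_apply (D.hasTemperateGrowth j), smul_eq_mul]
  have hFsum : ∀ (t : Finset (Fine R)) (ω : E3), 𝓕 (∑ j ∈ t, h j) ω = ∑ j ∈ t, 𝓕 (h j) ω := by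
    intro t ω
    have := map_sum (FourierTransform.fourierCLM ℂ 𝓢(E3, ℂ)) h t
    simp only [FourierTransform.fourierCLM_apply] at this
    rw [this, sum_apply]
  -- The Fourier support of `h j` is within `r⁻¹ ≤ σ` of its fat sector, so at most `530` terms are
  -- nonzero at `ω`. This holds for any subfamily, hence for any grouping into `τ`.
  have horth : ∀ (t : Finset (Fine R)) (ω : E3),
      ‖𝓕 (∑ j ∈ t, h j) ω‖ₑ ^ 2 ≤ 530 * ∑ j ∈ t, ‖𝓕 (h j) ω‖ₑ ^ 2 := by
    intro t ω
    rw [hFsum, ← Finset.sum_filter_ne_zero]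
    refine (pow_le_pow_left' (enorm_sum_le _ _) 2).trans ((sq_sum_le_card_mul _ _).trans ?_)
    gcongr
    · have hc := card_fatSector_le hσ0 hσ1 ω (t.filter fun j => 𝓕 (h j) ω ≠ 0) fun j hj => by
        obtain ⟨k, hk, hkd⟩ := (D.supported j).exists_dist_le hb (Finset.mem_filter.1 hj).2
        exact ⟨k, hk, hkd.trans hrσ⟩
      exact_mod_cast hc
    · exact Finset.filter_subset _ _
  have hcoarse : ∀ i x, (∑ j ∈ A.children s i, h j) x = coarsePiece D A s i x * 𝓕 b x := by
    intro i x
    rw [sum_apply, coarsePiece, Finset.sum_mul]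
    exact Finset.sum_congr rfl fun j _ => hhx j x
  have hms : ∀ g : 𝓢(E3, ℂ), Measurable fun x => ‖g x‖ₑ ^ 2 := fun g =>
    g.continuous.enorm.measurable.pow_const 2
  calc ∫⁻ x in B, ∑ i, ‖coarsePiece D A s i x‖ₑ ^ 2
      ≤ ∫⁻ x in B, 4 * ∑ i, ‖(∑ j ∈ A.children s i, h j) x‖ₑ ^ 2 := by
        refine setLIntegral_mono' hB fun x hx => ?_
        rw [Finset.mul_sum]
        refine Finset.sum_le_sum fun i _ => ?_
        rw [hcoarse, enorm_mul, mul_pow, mul_left_comm]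
        refine le_mul_of_one_le_right' ?_
        have h1 := ENNReal.ofReal_le_ofReal (hbB x hx)
        rw [ofReal_norm] at h1
        calc (1 : ℝ≥0∞) = 4 * ENNReal.ofReal (1 / 2) ^ 2 := by
              rw [← ENNReal.ofReal_pow (by norm_num),
                show (4 : ℝ≥0∞) = ENNReal.ofReal 4 by norm_num, ← ENNReal.ofReal_mul (by norm_num)]
              norm_num
          _ ≤ _ := by gcongr
    _ ≤ ∫⁻ x, 4 * ∑ i, ‖(∑ j ∈ A.children s i, h j) x‖ₑ ^ 2 := setLIntegral_le_lintegral _ _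
    _ = 4 * ∑ i, ∫⁻ ω, ‖𝓕 (∑ j ∈ A.children s i, h j) ω‖ₑ ^ 2 := by
        rw [lintegral_const_mul _ (Finset.measurable_fun_sum _ fun i _ => hms _),
          lintegral_finsetSum _ fun i _ => hms _]
        simp_rw [lintegral_enorm_sq_fourier]
    _ ≤ 4 * ∑ i, ∫⁻ ω, 530 * ∑ j ∈ A.children s i, ‖𝓕 (h j) ω‖ₑ ^ 2 := by
        gcongr with i _ ω
        exact horth _ ω
    _ = 4 * ∑ i, 530 * ∑ j ∈ A.children s i, ∫⁻ x, ‖h j x‖ₑ ^ 2 := by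
        congr 1
        refine Finset.sum_congr rfl fun i _ => ?_
        rw [lintegral_const_mul _ (Finset.measurable_fun_sum _ fun j _ => hms _),
          lintegral_finsetSum _ fun j _ => hms _]
        simp_rw [lintegral_enorm_sq_fourier]
    _ = 2120 * ∑ j, ∫⁻ x, ‖h j x‖ₑ ^ 2 := by
        rw [← Finset.mul_sum, ← mul_assoc, ← Finset.sum_fiberwise Finset.univ (A.parent s)]
        norm_num
        rfl
    _ = 2120 * ∫⁻ x, ‖𝓕 b x‖ₑ ^ 2 * ∑ j, ‖D.piece j x‖ₑ ^ 2 := by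
        rw [← lintegral_finsetSum _ fun j _ => hms _]
        congr 2; ext x
        rw [Finset.mul_sum]
        exact Finset.sum_congr rfl fun j _ => by rw [hhx, enorm_mul, mul_pow, mul_comm]

/-- Schwartz decay of order `2` becomes the order `4` of the weight after squaring. -/
theorem exists_weight_bound (η : 𝓢(E3, ℂ)) :
    ∃ a : ℝ≥0, ∀ (ρ : ℝ) (x : E3), ‖η (ρ⁻¹ • x)‖ₑ ^ 2 ≤ a * weight ρ x := by
  set c : ℝ := 2 ^ 2 * (Finset.Iic ((2 : ℕ), (0 : ℕ))).sup
    (fun m => SchwartzMap.seminorm ℝ m.1 m.2) η with hc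
  have hb : ∀ x, (1 + ‖x‖) ^ 2 * ‖η x‖ ≤ c := by
    intro x
    have := SchwartzMap.one_add_le_sup_seminorm_apply (𝕜 := ℝ) (m := (2, 0)) (k := 2) (n := 0)
      le_rfl le_rfl η x
    simpa using this
  have hc0 : 0 ≤ c := le_trans (by positivity) (hb 0)
  refine ⟨Real.toNNReal (c ^ 2), fun ρ x => ?_⟩
  have h := hb (ρ⁻¹ • x)
  rw [weight, ← ofReal_norm, ← ENNReal.ofReal_pow (norm_nonneg _)]
  change _ ≤ ENNReal.ofReal (c ^ 2) * _
  rw [← ENNReal.ofReal_mul (by positivity)]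
  refine ENNReal.ofReal_le_ofReal ?_
  have hp : 0 < 1 + ‖ρ⁻¹ • x‖ := by positivity
  have e : (1 + ‖ρ⁻¹ • x‖) ^ (-4 : ℝ) = ((1 + ‖ρ⁻¹ • x‖) ^ 4)⁻¹ := by
    rw [Real.rpow_neg hp.le]; norm_cast
  rw [e, ← div_eq_mul_inv, le_div_iff₀ (by positivity)]
  calc ‖η (ρ⁻¹ • x)‖ ^ 2 * (1 + ‖ρ⁻¹ • x‖) ^ 4
      = ((1 + ‖ρ⁻¹ • x‖) ^ 2 * ‖η (ρ⁻¹ • x)‖) ^ 2 := by ring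
    _ ≤ c ^ 2 := pow_le_pow_left₀ (by positivity) h 2

/-- The sum over balls is controlled by the `L⁴` norm of the full square function. -/
theorem exists_ballSum_le (M : ℕ) : ∃ C : ℝ≥0∞, C ≠ ⊤ ∧ ∀ {R r : ℝ}, 100 ≤ R → √R ≤ r →
    ∀ {f : E3 → ℂ} (D : Decomposition R f) (A : Nesting R) (B : Set E3), IsBallCover M r B →
      ballSum D A r B ≤ C * ∫⁻ x, (∑ j, ‖D.piece j x‖ₑ ^ 2) ^ 2 := by
  obtain ⟨η, -, -, hη2, hη⟩ := exists_bandlimited_cutoff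
  obtain ⟨a, ha⟩ := exists_weight_bound η
  set β := volume (Metric.ball (0 : E3) 1) with hβ
  have hβ0 : β ≠ 0 := (Metric.measure_ball_pos volume _ one_pos).ne'
  have hβt : β ≠ ⊤ := measure_ball_lt_top.ne
  set I := ∫⁻ x, weight 1 x with hI
  have hIt : I ≠ ⊤ := lintegral_weight_ne_top
  refine ⟨(2120 * a) ^ 2 * (β⁻¹ * I) * (16 * M * I * β⁻¹), ?_, ?_⟩
  · have hβi : β⁻¹ ≠ ⊤ := ENNReal.inv_ne_top.2 hβ0
    finiteness
  intro R r hR hr f D A B hB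
  have hr0 : 0 < r := lt_of_lt_of_le (Real.sqrt_pos.2 (by linarith)) hr
  have hr3 : ENNReal.ofReal (r ^ 3) ≠ 0 := by
    rw [Ne, ENNReal.ofReal_eq_zero, not_le]; positivity
  set G : E3 → ℝ≥0∞ := fun x => ∑ j, ‖D.piece j x‖ₑ ^ 2 with hG
  have hGm : Measurable G := Finset.measurable_fun_sum _ fun j _ =>
    (D.measurable_piece j).enorm.pow_const 2
  have hwm : ∀ v : E3, Measurable fun x => weight r (x - v) := fun v =>
    (measurable_weight r).comp (measurable_id.sub_const v)
  -- Local orthogonality, then Cauchy–Schwarz in the weight: its mass, of order `r³`, cancels the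
  -- factor `|B_r|⁻¹`.
  have hball : ∀ v : E3, (volume (Metric.closedBall v r))⁻¹ *
      (∫⁻ x in Metric.closedBall v r, ∑ i, ‖coarsePiece D A (√r)⁻¹ i x‖ₑ ^ 2) ^ 2 ≤
      (2120 * a) ^ 2 * (β⁻¹ * I) * ∫⁻ x, weight r (x - v) * G x ^ 2 := by
    intro v
    obtain ⟨b, hb, hbη⟩ := hη v r hr0
    have h1 : ∫⁻ x in Metric.closedBall v r, ∑ i, ‖coarsePiece D A (√r)⁻¹ i x‖ₑ ^ 2 ≤
        2120 * a * ∫⁻ x, weight r (x - v) * G x := by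
      refine (lintegral_ball_le hR D A hr hb Metric.isClosed_closedBall.measurableSet
        fun x hx => ?_).trans ?_
      · rw [hbη]
        refine hη2 _ ?_
        rw [norm_smul, norm_inv, Real.norm_of_nonneg hr0.le, ← dist_eq_norm, inv_mul_le_iff₀ hr0,
          mul_one]
        exact hx
      · rw [mul_assoc]
        gcongr
        have hm : Measurable fun x => weight r (x - v) * G x := (hwm v).mul hGm
        rw [← lintegral_const_mul _ hm]
        refine lintegral_mono fun x => ?_
        rw [hbη, ← mul_assoc]
        gcongr
        exact ha r (x - v)
    have h2 := lintegral_mul_sq_le (hwm v) hGm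
    rw [lintegral_sub_right_eq_self (weight r) v, lintegral_weight hr0] at h2
    rw [Measure.addHaar_closedBall _ _ hr0.le, finrank_euclideanSpace_fin,
      ENNReal.mul_inv (Or.inl hr3) (Or.inl ENNReal.ofReal_ne_top)]
    calc (ENNReal.ofReal (r ^ 3))⁻¹ * β⁻¹ *
          (∫⁻ x in Metric.closedBall v r, ∑ i, ‖coarsePiece D A (√r)⁻¹ i x‖ₑ ^ 2) ^ 2
        ≤ (ENNReal.ofReal (r ^ 3))⁻¹ * β⁻¹ * ((2120 * a) ^ 2 *
          (ENNReal.ofReal (r ^ 3) * I * ∫⁻ x, weight r (x - v) * G x ^ 2)) := by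
          refine mul_le_mul_right ((pow_le_pow_left' h1 2).trans ?_) _
          rw [mul_pow]
          exact mul_le_mul_right h2 _
      _ = ((ENNReal.ofReal (r ^ 3))⁻¹ * ENNReal.ofReal (r ^ 3)) * ((2120 * a) ^ 2 * (β⁻¹ * I) *
            ∫⁻ x, weight r (x - v) * G x ^ 2) := by ring
      _ = _ := by rw [ENNReal.inv_mul_cancel hr3 ENNReal.ofReal_ne_top, one_mul]
  rw [ballSum_eq]
  refine (ENNReal.tsum_le_tsum fun v : B => hball v).trans ?_
  rw [ENNReal.tsum_mul_left, mul_assoc _ (16 * _ * _ * _)]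
  gcongr
  -- Passing to finite subfamilies lets sum and integral be exchanged without countability of `B`.
  rw [ENNReal.tsum_eq_iSup_sum]
  refine iSup_le fun t => ?_
  have hm : ∀ v : B, Measurable fun x => weight r (x - v) * G x ^ 2 := fun v =>
    (hwm v).mul (hGm.pow_const 2)
  rw [← lintegral_finsetSum _ fun v _ => hm v, ← lintegral_const_mul _ (hGm.pow_const 2)]
  refine lintegral_mono fun x => ?_
  rw [← Finset.sum_mul]
  gcongr
  exact sum_weight_le hr0 hB t x

end

end ConeSq

/-! ### Conclusion. -/

/-- Ball inflation: `S(r₁, r²) ≤ C` for `r ≥ 10` and `r ≤ r₁ ≤ r²`, where `C` depends only on the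
bound `M` for the overlap of the balls. -/
theorem lemma3p1 (M : ℕ) :
    ∃ C : ℝ≥0, ∀ r r₁ : ℝ, 10 ≤ r → r ≤ r₁ → r₁ ≤ r ^ 2 →
      ConeSq.S M r₁ (r ^ 2) ≤ (C : ℝ≥0∞) := by
  obtain ⟨C, hC, h⟩ := ConeSq.exists_ballSum_le M
  refine ⟨(C * (154 * ENNReal.ofReal (864 * (12 * 80000) ^ 6))).toNNReal,
    fun r r₁ hr hr₁ _ => ?_⟩
  rw [ENNReal.coe_toNNReal (by finiteness)]
  refine sInf_le fun f _ D A B hB T hT => ?_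
  -- This makes `σ ≤ 1 / 10`, the smallness on which the sector geometry rests.
  have hR : 100 ≤ r ^ 2 := by nlinarith
  refine (h hR (by rwa [Real.sqrt_sq (by linarith)]) D A B hB).trans ?_
  rw [mul_assoc]
  gcongr
  exact ConeSq.lintegral_square_sq_le_multiscaleSum hR D A T hT
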